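/- Notation. A \emph{quasi-Lévy type measure} is a real function $\nu$ on the Borel subsets of $\mathbb{R}$ bounded away from $0$ such that, for every $r>0$, its restriction to the Borel sets disjoint from $(-r,r)$ is a finite signed measure, and such that $\int_{\mathbb{R}}(1\wedge x^2)\,|\nu|(dx)<\infty$; here $|\nu|,\nu^+,\nu^-$ are the unique measures on $\mathbb{R}$ that do not charge $\{0\}$ and coincide on Borel sets bounded away from $0$ with the total variation, positive part and negative part of these restrictions. A probability measure $\mu$ on $\mathbb{R}$ with characteristic function $\hat\mu(z)=\int e^{ixz}\mu(dx)$ is \emph{quasi-infinitely divisible} if there are $a,\gamma\in\mathbb{R}$ and a quasi-Lévy type measure $\nu$ with $$\hat\mu(z)=\exp\Big(-\tfrac12 az^2+i\gamma z+\int_{\mathbb{R}}\big(e^{ixz}-1-ixz\mathbf 1_{[-1,1]}(x)\big)\,\nu(dx)\Big),\qquad z\in\mathbb{R}.$$ The (unique) triplet $(a,\gamma,\nu)$ is the characteristic triplet of $\mu$, $a$ is its Gaussian variance, $\nu$ its quasi-Lévy measure, and, if $\int_{[-1,1]}|x|\,|\nu|(dx)<\infty$, $\gamma-\int_{[-1,1]}x\,\nu(dx)$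 is its drift. For a continuous $F:\mathbb{R}\to\mathbb{C}\setminus\{0\}$ with non-zero limits at $\pm\infty$, the \emph{index} of $F$ is $\frac1{2\pi}\big(\lim_{z\to\infty}\theta(z)-\lim_{z\to-\infty}\theta(z)\big)$, where $\theta:\mathbb{R}\to\mathbb{R}$ is continuous with $F/|F|=e^{i\theta}$. \textbf{Theorem.} Let $\mu(dx)=p\,\delta_{x_0}(dx)+(1-p)f(x)\,\lambda(dx)$, where $p\in(0,1)$, $x_0\in\mathbb{R}$, $\lambda$ is Lebesgue measure and $f$ is a probability density with respect to $\lambda$. Then $\mu$ is quasi-infinitely divisible if and only if $\hat\mu(z)\neq0$ for every $z\in\mathbb{R}$. In that case the index $m$ of the characteristic function of $\mu*\delta_{-x_0}$ exists and is an integer, and there is a $g\in L^1(\mathbb{R},\mathbb{R})$ such that the quasi-Lévy measure $\nu$ of $\mu$ is given by $$\nu(dx)=\Big(g(x)+\frac{m e^{-|x|}}{|x|}\big(\mathbf 1_{(0,\infty)}(x)-\mathbf 1_{(-\infty,0)}(x)\big)\Big)\lambda(dx).$$ Furthermore $\int_{-1}^1|x|\,|\nu|(dx)<\infty$, and $\mu$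 has drift $x_0$ and Gaussian variance $0$. Finally, $|\nu|$ is finite if and only if $m=0$, and if $m\neq0$ then $\nu^-(\mathbb{R})=\nu^+(\mathbb{R})=\infty$. -/

import Mathlib

open MeasureTheory Filter Topology

/-- `IsBorelOff r B`: the set `B` is Borel and `B ∩ (-r, r) = ∅`. -/
def IsBorelOff (r : ℝ) (B : Set ℝ) : Prop :=
  MeasurableSet B ∧ B ∩ Set.Ioo (-r) r = ∅

theorem IsBorelOff.diff {B : Set ℝ} (hB : MeasurableSet B) (r : ℝ) :
    IsBorelOff r (B \ Set.Ioo (-r) r) :=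
  ⟨hB.diff measurableSet_Ioo, by ext x; simp⟩

theorem IsBorelOff.diff_eq {r : ℝ} {B : Set ℝ} (hB : IsBorelOff r B) :
    B \ Set.Ioo (-r) r = B :=
  sdiff_eq_left.2 (Set.disjoint_iff_inter_eq_empty.2 hB.2)

theorem IsBorelOff.mono {r s : ℝ} (hrs : r ≤ s) {B : Set ℝ} (hB : IsBorelOff s B) :
    IsBorelOff r B :=
  ⟨hB.1, Set.eq_empty_of_subset_empty
    (hB.2 ▸ Set.inter_subset_inter_right B (Set.Ioo_subset_Ioo (neg_le_neg hrs) hrs))⟩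

/-- A real function on the Borel sets bounded away from zero which, for every `r > 0`, is a finite
signed measure on the Borel sets disjoint from `(-r, r)`.  Only the values of `toFun` on Borel sets
bounded away from zero matter; no definition below looks at any other value. -/
structure SignedMeasureOffZero where
  toFun : Set ℝ → ℝ
  empty : toFun ∅ = 0
  hasSum_iUnion : ∀ r : ℝ, 0 < r → ∀ B : ℕ → Set ℝ, (∀ n, IsBorelOff r (B n)) →
    Pairwise (Function.onFun Disjoint B) → HasSum (fun n => toFun (B n)) (toFun (⋃ n, B n))

namespace SignedMeasureOffZero

variable (ν : SignedMeasureOffZero)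

open Classical in
/-- The restriction `ν_r` of `ν` to the Borel sets disjoint from `(-r, r)`, as a finite signed
measure on `ℝ` that vanishes inside `(-r, r)`. -/
noncomputable def restr (r : ℝ) (hr : 0 < r) : SignedMeasure ℝ where
  measureOf' B := if MeasurableSet B then ν.toFun (B \ Set.Ioo (-r) r) else 0
  empty' := by simp [ν.empty]
  not_measurable' _ hB := if_neg hB
  m_iUnion' B hB hd := by
    have h := ν.hasSum_iUnion r hr (fun n => B n \ Set.Ioo (-r) r)
      (fun n => IsBorelOff.diff (hB n) r)
      (fun i j hij => (hd hij).mono Set.sdiff_subset Set.sdiff_subset)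
    rw [← Set.iUnion_sdiff] at h
    simpa [hB, MeasurableSet.iUnion hB] using h

theorem restr_apply {r : ℝ} (hr : 0 < r) {B : Set ℝ} (hB : MeasurableSet B) :
    ν.restr r hr B = ν.toFun (B \ Set.Ioo (-r) r) :=
  if_pos hB

theorem restr_apply_of_isBorelOff {r : ℝ} (hr : 0 < r) {B : Set ℝ} (hB : IsBorelOff r B) :
    ν.restr r hr B = ν.toFun B := by
  rw [restr_apply ν hr hB.1, hB.diff_eq]

/-- The shells `{1 ≤ |x|}`, `{1/2 ≤ |x| < 1}`, `{1/3 ≤ |x| < 1/2}`, …, which partition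
`ℝ \ {0}`. -/
def shell : ℕ → Set ℝ :=
  disjointed fun n : ℕ => (Set.Ioo (-(1 / ((n : ℝ) + 1))) (1 / ((n : ℝ) + 1)))ᶜ

/-- The positive part `ν⁺` of `ν`: on each shell it is the positive part of the Jordan decomposition
of the corresponding restriction of `ν`, and it does not charge `0`. -/
noncomputable def posPart : Measure ℝ :=
  Measure.sum fun n : ℕ =>
    (ν.restr (1 / ((n : ℝ) + 1)) Nat.one_div_pos_of_nat).toJordanDecomposition.posPart.restrict
      (shell n)

/-- The negative part `ν⁻` of `ν`. -/
noncomputable def negPart : Measure ℝ :=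
  Measure.sum fun n : ℕ =>
    (ν.restr (1 / ((n : ℝ) + 1)) Nat.one_div_pos_of_nat).toJordanDecomposition.negPart.restrict
      (shell n)

/-- The total variation `|ν|` of `ν`. -/
noncomputable def totalVariation : Measure ℝ :=
  ν.posPart + ν.negPart

/-- The integral of `f` against `ν`. -/
noncomputable def integral {E : Type*} [NormedAddCommGroup E] [NormedSpace ℝ E] (f : ℝ → E) : E :=
  ∫ x, f x ∂ν.posPart - ∫ x, f x ∂ν.negPart

/-! The three measures `ν⁺`, `ν⁻`, `|ν|` do not charge `0`, and on Borel sets disjoint from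
`(-r, r)` they agree with the positive part, the negative part and the total variation of the
finite signed measure `ν_r`. -/

theorem measurableSet_shell (n : ℕ) : MeasurableSet (shell n) :=
  MeasurableSet.disjointed (fun _ => measurableSet_Ioo.compl) n

theorem iUnion_shell : ⋃ n, shell n = {(0 : ℝ)}ᶜ := by
  rw [shell, iUnion_disjointed, ← Set.compl_iInter]
  congr 1
  ext x
  simp only [Set.mem_iInter, Set.mem_Ioo, ← abs_lt, Set.mem_singleton_iff]
  constructor
  · intro h
    by_contra hx
    obtain ⟨n, hn⟩ := exists_nat_one_div_lt (abs_pos.2 hx)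
    exact absurd (h n) (not_lt.2 hn.le)
  · rintro rfl n
    rw [abs_zero]
    exact Nat.one_div_pos_of_nat

theorem isBorelOff_inter_shell {A : Set ℝ} (hA : MeasurableSet A) (n : ℕ) :
    IsBorelOff (1 / ((n : ℝ) + 1)) (A ∩ shell n) := by
  refine ⟨hA.inter (measurableSet_shell n), ?_⟩
  ext x
  simp only [Set.mem_inter_iff, Set.mem_empty_iff_false, iff_false, not_and]
  intro hx
  exact disjointed_subset _ n hx.2

theorem toJordanDecomposition_restrict (s : SignedMeasure ℝ) {D : Set ℝ} (hD : MeasurableSet D) :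
    (SignedMeasure.toJordanDecomposition (s.restrict D)).posPart = s.toJordanDecomposition.posPart.restrict D ∧
    (SignedMeasure.toJordanDecomposition (s.restrict D)).negPart = s.toJordanDecomposition.negPart.restrict D := by
  let j : JordanDecomposition ℝ :=
    { posPart := s.toJordanDecomposition.posPart.restrict D
      negPart := s.toJordanDecomposition.negPart.restrict D
      mutuallySingular := (s.toJordanDecomposition.mutuallySingular.restrict D).symm.restrict D
        |>.symm }
  have h : (SignedMeasure.toJordanDecomposition (s.restrict D)) = j := by
    apply SignedMeasure.toJordanDecomposition_eq
    ext i hi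
    rw [VectorMeasure.restrict_apply _ hD hi, JordanDecomposition.toSignedMeasure,
      Measure.toSignedMeasure_sub_apply hi, measureReal_restrict_apply hi,
      measureReal_restrict_apply hi, s.apply_eq_posPart_real_sub_negPart_real (hi.inter hD)]
  rw [h]
  exact ⟨rfl, rfl⟩

theorem restr_eq_restrict {r s : ℝ} (hr : 0 < r) (hs : 0 < s) (hrs : r ≤ s) :
    ν.restr s hs = (ν.restr r hr).restrict (Set.Ioo (-s) s)ᶜ := by
  ext B hB
  rw [VectorMeasure.restrict_apply _ measurableSet_Ioo.compl hB, restr_apply ν hs hB,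
    ← Set.sdiff_eq, restr_apply_of_isBorelOff ν hr ((IsBorelOff.diff hB s).mono hrs)]

theorem restr_parts_eq_of_le {r s : ℝ} (hr : 0 < r) (hs : 0 < s) (hrs : r ≤ s) {A : Set ℝ}
    (hA : IsBorelOff s A) :
    (ν.restr s hs).toJordanDecomposition.posPart A =
      (ν.restr r hr).toJordanDecomposition.posPart A ∧
    (ν.restr s hs).toJordanDecomposition.negPart A =
      (ν.restr r hr).toJordanDecomposition.negPart A := by
  obtain ⟨h₁, h₂⟩ :=
    toJordanDecomposition_restrict (ν.restr r hr) (measurableSet_Ioo (a := -s) (b := s)).compl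
  rw [ν.restr_eq_restrict hr hs hrs, h₁, h₂, Measure.restrict_apply hA.1,
    Measure.restrict_apply hA.1, ← Set.sdiff_eq, hA.diff_eq]
  exact ⟨rfl, rfl⟩

theorem restr_parts_eq {r s : ℝ} (hr : 0 < r) (hs : 0 < s) {A : Set ℝ}
    (hAr : IsBorelOff r A) (hAs : IsBorelOff s A) :
    (ν.restr s hs).toJordanDecomposition.posPart A =
      (ν.restr r hr).toJordanDecomposition.posPart A ∧
    (ν.restr s hs).toJordanDecomposition.negPart A =
      (ν.restr r hr).toJordanDecomposition.negPart A := by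
  rcases le_total r s with h | h
  · exact ν.restr_parts_eq_of_le hr hs h hAs
  · exact (ν.restr_parts_eq_of_le hs hr h hAr).imp Eq.symm Eq.symm

theorem measure_eq_tsum_shell (m : Measure ℝ) {r : ℝ} (hr : 0 < r) {A : Set ℝ}
    (hA : IsBorelOff r A) : m A = ∑' n, m (A ∩ shell n) := by
  rw [← measure_iUnion (f := fun n => A ∩ shell n) (fun i j hij => (disjoint_disjointed _ hij).mono Set.inter_subset_right
    Set.inter_subset_right) (fun n => hA.1.inter (measurableSet_shell n)), ← Set.inter_iUnion,
    iUnion_shell, Set.inter_eq_left.2]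
  rintro x hx rfl
  have : (0 : ℝ) ∈ A ∩ Set.Ioo (-r) r := ⟨hx, by simpa using hr⟩
  rw [hA.2] at this
  exact this

theorem parts_apply {r : ℝ} (hr : 0 < r) {A : Set ℝ} (hA : IsBorelOff r A) :
    ν.posPart A = (ν.restr r hr).toJordanDecomposition.posPart A ∧
    ν.negPart A = (ν.restr r hr).toJordanDecomposition.negPart A := by
  have key : ∀ n : ℕ, IsBorelOff r (A ∩ shell n) := fun n =>
    ⟨hA.1.inter (measurableSet_shell n), Set.eq_empty_of_subset_empty
      (hA.2 ▸ Set.inter_subset_inter_left _ Set.inter_subset_left)⟩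
  rw [posPart, negPart, Measure.sum_apply _ hA.1, Measure.sum_apply _ hA.1,
    measure_eq_tsum_shell _ hr hA, measure_eq_tsum_shell (ν.restr r hr).toJordanDecomposition.negPart
    hr hA]
  constructor
  · refine tsum_congr fun n => ?_
    rw [Measure.restrict_apply hA.1]
    exact (ν.restr_parts_eq hr _ (key n) (isBorelOff_inter_shell hA.1 n)).1
  · refine tsum_congr fun n => ?_
    rw [Measure.restrict_apply hA.1]
    exact (ν.restr_parts_eq hr _ (key n) (isBorelOff_inter_shell hA.1 n)).2

theorem posPart_apply {r : ℝ} (hr : 0 < r) {A : Set ℝ} (hA : IsBorelOff r A) :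
    ν.posPart A = (ν.restr r hr).toJordanDecomposition.posPart A :=
  (ν.parts_apply hr hA).1

theorem negPart_apply {r : ℝ} (hr : 0 < r) {A : Set ℝ} (hA : IsBorelOff r A) :
    ν.negPart A = (ν.restr r hr).toJordanDecomposition.negPart A :=
  (ν.parts_apply hr hA).2

theorem totalVariation_apply {r : ℝ} (hr : 0 < r) {A : Set ℝ} (hA : IsBorelOff r A) :
    ν.totalVariation A = (ν.restr r hr).totalVariation A := by
  rw [totalVariation, SignedMeasure.totalVariation, Measure.add_apply, Measure.add_apply,
    ν.posPart_apply hr hA, ν.negPart_apply hr hA]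

theorem zero_notMem_shell (n : ℕ) : (0 : ℝ) ∉ shell n := fun h => by
  have : (0 : ℝ) ∈ ⋃ n, shell n := Set.mem_iUnion.2 ⟨n, h⟩
  simp [iUnion_shell] at this

theorem posPart_singleton_zero : ν.posPart {0} = 0 := by
  rw [posPart, Measure.sum_apply _ (measurableSet_singleton 0), ENNReal.tsum_eq_zero]
  intro n
  rw [Measure.restrict_apply (measurableSet_singleton 0),
    Set.singleton_inter_eq_empty.2 (zero_notMem_shell n), measure_empty]

theorem negPart_singleton_zero : ν.negPart {0} = 0 := by
  rw [negPart, Measure.sum_apply _ (measurableSet_singleton 0), ENNReal.tsum_eq_zero]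
  intro n
  rw [Measure.restrict_apply (measurableSet_singleton 0),
    Set.singleton_inter_eq_empty.2 (zero_notMem_shell n), measure_empty]

theorem totalVariation_singleton_zero : ν.totalVariation {0} = 0 := by
  rw [totalVariation, Measure.add_apply, posPart_singleton_zero, negPart_singleton_zero, add_zero]

end SignedMeasureOffZero

/-- A quasi-Lévy type measure: additionally `∫ (1 ∧ x²) |ν|(dx) < ∞`. -/
structure QuasiLevyTypeMeasure extends SignedMeasureOffZero where
  lintegral_lt_top :
    ∫⁻ x, ENNReal.ofReal (min 1 (x ^ 2)) ∂toSignedMeasureOffZero.totalVariation < ⊤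

/-- `(a, γ, ν)` is a characteristic triplet of `μ`: the Lévy-Khintchine representation with
truncation function `x ↦ x 1_{[-1,1]}(x)` holds. -/
def IsCharacteristicTriplet (μ : Measure ℝ) (a γ : ℝ) (ν : QuasiLevyTypeMeasure) : Prop :=
  ∀ z : ℝ, charFun μ z =
    Complex.exp (-(1 / 2) * a * z ^ 2 + Complex.I * γ * z +
      ν.integral fun x : ℝ => Complex.exp (Complex.I * x * z) - 1
        - Complex.I * x * z * (Set.Icc (-1) 1).indicator (fun _ => (1 : ℂ)) x)

/-- A probability distribution is quasi-infinitely divisible if it has a characteristic triplet. -/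
def IsQuasiInfinitelyDivisible (μ : Measure ℝ) [IsProbabilityMeasure μ] : Prop :=
  ∃ (a γ : ℝ) (ν : QuasiLevyTypeMeasure), IsCharacteristicTriplet μ a γ ν

/-- The drift `γ - ∫_{[-1,1]} x ν(dx)` belonging to a triplet `(a, γ, ν)`; meaningful when
`∫_{[-1,1]} |x| |ν|(dx) < ∞`. -/
noncomputable def drift (γ : ℝ) (ν : QuasiLevyTypeMeasure) : ℝ :=
  γ - ν.integral ((Set.Icc (-1) 1).indicator fun x : ℝ => x)

/-- `m` is the index of the curve `F`: there is a continuous `θ` with `F / |F| = exp (i θ)`, which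
has limits at `± ∞`, and `m = (θ(∞) - θ(-∞)) / (2π)`. -/
def HasIndex (F : ℝ → ℂ) (m : ℝ) : Prop :=
  ∃ θ : ℝ → ℝ, Continuous θ ∧ (∀ z, F z / ‖F z‖ = Complex.exp (Complex.I * θ z)) ∧
    ∃ l₁ l₂ : ℝ, Tendsto θ atBot (𝓝 l₁) ∧ Tendsto θ atTop (𝓝 l₂) ∧
      m = 1 / (2 * Real.pi) * (l₂ - l₁)

/-- The index does not depend on the choice of the continuous argument. -/
theorem HasIndex.unique {F : ℝ → ℂ} {m m' : ℝ} (h : HasIndex F m) (h' : HasIndex F m') :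
    m = m' := by
  obtain ⟨θ, hθ, hF, l₁, l₂, h₁, h₂, rfl⟩ := h
  obtain ⟨θ', hθ', hF', l₁', l₂', h₁', h₂', rfl⟩ := h'
  have hn : ∀ z, ∃ n : ℤ, (θ z - θ' z) / (2 * Real.pi) = n := fun z => by
    have hz := (hF z).symm.trans (hF' z)
    rw [Complex.exp_eq_exp_iff_exists_int] at hz
    obtain ⟨n, hn⟩ := hz
    refine ⟨n, ?_⟩
    rw [div_eq_iff (by positivity)]
    have : (Complex.I * ((θ z - θ' z : ℝ) : ℂ)) = Complex.I * ((n * (2 * Real.pi) : ℝ) : ℂ) := by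
      push_cast
      linear_combination hn
    exact_mod_cast mul_left_cancel₀ Complex.I_ne_zero this
  choose n hn using hn
  have hc : Continuous n := by
    rw [Int.isClosedEmbedding_coe_real.isEmbedding.continuous_iff]
    have : (fun z => (θ z - θ' z) / (2 * Real.pi)) = (fun k : ℤ => (k : ℝ)) ∘ n := funext hn
    rw [← this]
    fun_prop
  have hconst : ∀ z, θ z - θ' z = θ 0 - θ' 0 := fun z => by
    have h0 : n z = n 0 := PreconnectedSpace.constant inferInstance hc
    have := (hn z).trans ((congrArg (fun k : ℤ => (k : ℝ)) h0).trans (hn 0).symm)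
    field_simp at this
    exact this
  have e₁ : l₁ - l₁' = θ 0 - θ' 0 :=
    tendsto_nhds_unique (h₁.sub h₁') (by simp only [hconst]; exact tendsto_const_nhds)
  have e₂ : l₂ - l₂' = θ 0 - θ' 0 :=
    tendsto_nhds_unique (h₂.sub h₂') (by simp only [hconst]; exact tendsto_const_nhds)
  congr 1
  linarith

/-- The function `x ↦ g(x) + m e^{-|x|} / |x| (1_{(0,∞)}(x) - 1_{(-∞,0)}(x))`. -/
noncomputable def indexDensity (g : ℝ → ℝ) (m : ℝ) (x : ℝ) : ℝ :=
  g x + m * Real.exp (-|x|) / |x| *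
    ((Set.Ioi 0).indicator (fun _ => (1 : ℝ)) x - (Set.Iio 0).indicator (fun _ => (1 : ℝ)) x)

/-!
If `μ` has a characteristic triplet, its characteristic function is an exponential and has no zeros.
For the converse, the characteristic function of `μ * δ_{-x₀}` is `F = p + 𝓕 k` with `k` integrable,
an element of the Wiener algebra `ℂ + 𝓕 L¹` whose constant term `p` is non-zero. The task is to take
a logarithm of the zero-free function `F` inside this algebra, up to the winding of the curve.

The logarithm comes from an argument in the style of Newman's proof of Wiener's lemma. Approximate
`k` in `L¹` by a test function `s` and put `P = p + 𝓕 s`. The norms of the powers `P⁻ⁿ` grow like their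
supremum norms up to a factor `n²` (`isFourierL1_inv_pow_sub`), because `P` is smooth. Hence the
series of `log (F / P) = log (1 + 𝓕 (k - s) / P)` converges absolutely in the Wiener algebra, which is
complete (`IsFourierL1.of_hasSum`). For `P` itself, `P' / P` is the Fourier transform of a function
`r` that is integrable and Lipschitz at `0` (`exists_log_const_add_schwartz`). By Fubini, the
primitive of `P' / P` is the Lévy–Khintchine integral with density proportional to `r(x) / x`
(`intervalIntegral_fourier_eq`).

Mathlib's `𝓕` uses the frequency `w = -z / (2π)`, which reverses orientation, so the total winding
`∫ P' / P = r 0` equals `-2πim` with `m` the index. As `r` is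
Lipschitz at `0`, the density differs from `m e^{-|x|} / x` by an integrable function, which is the
asserted form of `ν` (`exists_index_and_density`). Since `F` is Hermitian, the uniqueness of
continuous logarithms allows replacing the density by its real part.

The remaining claims concern an arbitrary triplet, so they rest on uniqueness
(`IsCharacteristicTriplet.unique`): second differences of the exponents, with steps `1` and `√2`,
are characteristic functions of finite measures once negative parts have been moved across the
equation, and the weight they introduce vanishes only at `0` because `√2` is irrational. The drift,
the variance and the masses of `ν⁺` and `ν⁻` are then read off from the density; `e^{-|x|} / |x|` is
not integrable on either side of `0`.
-/

/-! ### The Wiener algebra of Fourier transforms of integrable functions -/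

open FourierTransform Complex in
/-- `IsFourierL1 C φ`: the function `φ` is the Fourier transform of an integrable function of
`L¹`-norm at most `C`.  These functions form the Wiener algebra (without unit). -/
def IsFourierL1 (C : ℝ) (φ : ℝ → ℂ) : Prop :=
  ∃ g : ℝ → ℂ, Integrable g ∧ ∫ x, ‖g x‖ ≤ C ∧ ∀ w, φ w = 𝓕 g w

namespace IsFourierL1

open FourierTransform Complex

theorem mono {C C' : ℝ} {φ : ℝ → ℂ} (h : IsFourierL1 C φ) (hC : C ≤ C') : IsFourierL1 C' φ := by
  obtain ⟨g, hg, hgC, hφ⟩ := h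
  exact ⟨g, hg, hgC.trans hC, hφ⟩

theorem nonneg {C : ℝ} {φ : ℝ → ℂ} (h : IsFourierL1 C φ) : 0 ≤ C := by
  obtain ⟨g, hg, hgC, hφ⟩ := h
  exact (integral_nonneg fun _ => norm_nonneg _).trans hgC

theorem const_mul {C : ℝ} {φ : ℝ → ℂ} (h : IsFourierL1 C φ) (a : ℂ) :
    IsFourierL1 (‖a‖ * C) (fun w => a * φ w) := by
  obtain ⟨g, hg, hgC, hφ⟩ := h
  refine ⟨fun x => a * g x, hg.const_mul a, ?_, fun w => ?_⟩
  · simp only [norm_mul, integral_const_mul]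
    gcongr
  · simp only [hφ]
    rw [Real.fourier_real_eq_integral_exp_smul, Real.fourier_real_eq_integral_exp_smul,
      ← integral_const_mul]
    congr 1 with x
    simp only [smul_eq_mul]
    ring

theorem add {C C' : ℝ} {φ φ' : ℝ → ℂ} (h : IsFourierL1 C φ) (h' : IsFourierL1 C' φ') :
    IsFourierL1 (C + C') (fun w => φ w + φ' w) := by
  obtain ⟨g, hg, hgC, hφ⟩ := h
  obtain ⟨g', hg', hgC', hφ'⟩ := h'
  refine ⟨fun x => g x + g' x, hg.add hg', ?_, fun w => ?_⟩
  · refine (integral_mono (hg.add hg').norm (hg.norm.add hg'.norm)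
      (fun x => norm_add_le (g x) (g' x))).trans ?_
    refine (integral_add hg.norm hg'.norm).trans_le ?_
    exact add_le_add hgC hgC'
  · simp only [hφ, hφ']
    rw [Real.fourier_eq, Real.fourier_eq, Real.fourier_eq,
      ← integral_add ((Real.fourierIntegral_convergent_iff w).2 hg)
        ((Real.fourierIntegral_convergent_iff w).2 hg')]
    simp

open Convolution in
theorem mul {C C' : ℝ} {φ φ' : ℝ → ℂ} (h : IsFourierL1 C φ) (h' : IsFourierL1 C' φ') :
    IsFourierL1 (C * C') (fun w => φ w * φ' w) := by
  have hC := h.nonneg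
  obtain ⟨g, hg, hgC, hφ⟩ := h
  obtain ⟨g', hg', hgC', hφ'⟩ := h'
  refine ⟨g ⋆[ContinuousLinearMap.mul ℂ ℂ] g', hg.integrable_convolution _ hg', ?_, fun w => ?_⟩
  · have key : ∫ x, ((fun x => ‖g x‖) ⋆[ContinuousLinearMap.mul ℝ ℝ] (fun x => ‖g' x‖)) x =
        (∫ x, ‖g x‖) * ∫ x, ‖g' x‖ := integral_convolution _ hg.norm hg'.norm
    calc ∫ x, ‖(g ⋆[ContinuousLinearMap.mul ℂ ℂ] g') x‖
        ≤ ∫ x, ((fun x => ‖g x‖) ⋆[ContinuousLinearMap.mul ℝ ℝ] (fun x => ‖g' x‖)) x := by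
          refine integral_mono (hg.integrable_convolution _ hg').norm
            (hg.norm.integrable_convolution _ hg'.norm) fun x => ?_
          refine (norm_integral_le_integral_norm _).trans_eq ?_
          simp [convolution]
      _ ≤ C * C' := by
          rw [key]
          exact mul_le_mul hgC hgC' (integral_nonneg fun _ => norm_nonneg _) hC
  · simp only [hφ, hφ', Real.fourier_mul_convolution_eq hg hg']

theorem pow_succ {C : ℝ} {φ : ℝ → ℂ} (h : IsFourierL1 C φ) (n : ℕ) :
    IsFourierL1 (C ^ (n + 1)) (fun w => φ w ^ (n + 1)) := by
  induction n with
  | zero => simpa using h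
  | succ n ih => simpa only [_root_.pow_succ _ (n + 1)] using ih.mul h

/-- The Wiener algebra is complete: an absolutely convergent series of its elements, summed
pointwise, stays in it. -/
theorem of_hasSum {C : ℕ → ℝ} {φ : ℕ → ℝ → ℂ} {Φ : ℝ → ℂ} (h : ∀ n, IsFourierL1 (C n) (φ n))
    (hC : Summable C) (hΦ : ∀ w, HasSum (fun n => φ n w) (Φ w)) :
    ∃ g : ℝ → ℂ, Integrable g ∧ ∀ w, Φ w = 𝓕 g w := by
  choose g hg hgC hφ using h
  have hs : Summable fun n => ∫ x, ‖g n x‖ :=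
    hC.of_nonneg_of_le (fun n => integral_nonneg fun _ => norm_nonneg _) hgC
  have hfin : ∑' n, ∫⁻ x, ‖g n x‖ₑ ≠ ⊤ := by
    have : ∀ n, ∫⁻ x, ‖g n x‖ₑ = ENNReal.ofReal (∫ x, ‖g n x‖) := fun n =>
      (ofReal_integral_norm_eq_lintegral_enorm (hg n)).symm
    simp_rw [this]
    exact hs.tsum_ofReal_ne_top
  have hae : ∀ᵐ x, Summable fun n => g n x := by
    rw [← lintegral_tsum fun n => (hg n).1.enorm] at hfin
    filter_upwards [ae_lt_top' (AEMeasurable.tsum fun n => (hg n).1.enorm) hfin] with x hx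
    refine Summable.of_norm ?_
    simpa using ENNReal.summable_toReal hx.ne
  have hG : Integrable fun x => ∑' n, g n x := by
    refine ⟨?_, ?_⟩
    · refine aestronglyMeasurable_of_tendsto_ae atTop (f := fun N x => ∑ n ∈ Finset.range N, g n x)
        (fun N => Finset.aestronglyMeasurable_fun_sum _ fun n _ => (hg n).1) ?_
      filter_upwards [hae] with x hx using hx.hasSum.tendsto_sum_nat
    · refine (lintegral_mono fun x => enorm_tsum_le_tsum_enorm).trans_lt ?_
      rw [lintegral_tsum fun n => (hg n).1.enorm]
      exact hfin.lt_top
  refine ⟨_, hG, fun w => (hΦ w).unique ?_⟩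
  have := hasSum_integral_of_summable_integral_norm
    (F := fun n x => Real.fourierChar (-(inner ℝ x w)) • g n x)
    (fun n => (Real.fourierIntegral_convergent_iff w).2 (hg n)) (by simpa using hs)
  simp only [hφ, Real.fourier_eq]
  convert! this using 3 with x
  simp only [Circle.smul_def, smul_eq_mul, tsum_mul_left]

end IsFourierL1

open FourierTransform Complex in
/-- A function with two integrable derivatives is the Fourier transform of its inverse Fourier
transform, which decays quadratically. -/
theorem fourier_fourierInv_of_hasDerivAt {h h₁ h₂ : ℝ → ℂ} (hd : ∀ x, HasDerivAt h (h₁ x) x)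
    (hd₁ : ∀ x, HasDerivAt h₁ (h₂ x) x) (hi : Integrable h) (hi₁ : Integrable h₁)
    (hi₂ : Integrable h₂) :
    Integrable (𝓕⁻ h) ∧ ∫ x, ‖𝓕⁻ h x‖ ≤ Real.pi * ((∫ x, ‖h x‖) + ∫ x, ‖h₂ x‖) ∧
      𝓕 (𝓕⁻ h) = h := by
  have e₁ : deriv h = h₁ := funext fun x => (hd x).deriv
  have e₂ : deriv h₁ = h₂ := funext fun x => (hd₁ x).deriv
  have hc : Continuous h := continuous_iff_continuousAt.2 fun x => (hd x).continuousAt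
  have bound : ∀ (f : ℝ → ℂ) (w : ℝ), ‖𝓕 f w‖ ≤ ∫ x, ‖f x‖ := fun f w =>
    VectorFourier.norm_fourierIntegral_le_integral_norm _ _ _ _ _
  set K := (∫ x, ‖h x‖) + ∫ x, ‖h₂ x‖ with hK
  have hF : ∀ w, ‖𝓕 h w‖ ≤ K * (1 + w ^ 2)⁻¹ := fun w => by
    have h2 : 𝓕 h₂ w = (2 * Real.pi * I * w) • (2 * Real.pi * I * w) • 𝓕 h w := by
      rw [← e₂, Real.fourier_deriv hi₁ (fun x => (hd₁ x).differentiableAt) (by rwa [e₂])]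
      simp only
      rw [← e₁, Real.fourier_deriv hi (fun x => (hd x).differentiableAt) (by rwa [e₁])]
    have h3 : (2 * Real.pi * |w|) ^ 2 * ‖𝓕 h w‖ ≤ ∫ x, ‖h₂ x‖ := by
      refine le_trans (le_of_eq ?_) (bound h₂ w)
      rw [h2]
      simp only [norm_smul, norm_mul, Complex.norm_real, Complex.norm_I, Real.norm_eq_abs,
        Complex.norm_ofNat, abs_of_pos Real.pi_pos]
      ring
    rw [← div_eq_mul_inv, le_div_iff₀ (by positivity)]
    have h4 := bound h w
    have h5 : w ^ 2 ≤ (2 * Real.pi * |w|) ^ 2 := by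
      rw [mul_pow, sq_abs]
      exact le_mul_of_one_le_left (sq_nonneg w)
        (one_le_pow₀ (by linarith [Real.pi_gt_three]))
    have h6 := mul_le_mul_of_nonneg_right h5 (norm_nonneg (𝓕 h w))
    linarith
  have hFc : Continuous (𝓕 h) :=
    VectorFourier.fourierIntegral_continuous Real.continuous_fourierChar (by fun_prop) hi
  have hdom : Integrable fun w : ℝ => K * (1 + w ^ 2)⁻¹ := integrable_inv_one_add_sq.const_mul K
  have hFi : Integrable (𝓕 h) := hdom.mono' hFc.aestronglyMeasurable (ae_of_all _ hF)
  have hinv : 𝓕⁻ h = fun x => 𝓕 h (-x) := by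
    ext x
    exact Real.fourierInv_eq_fourier_neg h x
  refine ⟨by rw [hinv]; exact hFi.comp_neg, ?_, hc.fourier_fourierInv_eq hi hFi⟩
  rw [hinv, integral_neg_eq_self (fun x => ‖𝓕 h x‖)]
  refine (integral_mono hFi.norm hdom hF).trans_eq ?_
  rw [integral_const_mul, integral_univ_inv_one_add_sq, mul_comm]

/-! ### Powers and logarithms of Schwartz perturbations of constants -/

theorem norm_pow_sub_pow_le_mul {a b : ℂ} {M : ℝ} (ha : ‖a‖ ≤ M) (hb : ‖b‖ ≤ M) (n : ℕ) :
    ‖a ^ (n + 1) - b ^ (n + 1)‖ ≤ (n + 1) * M ^ n * ‖a - b‖ := by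
  have hM : 0 ≤ M := (norm_nonneg a).trans ha
  induction n with
  | zero => simp
  | succ n ih =>
    have e : a ^ (n + 1 + 1) - b ^ (n + 1 + 1) =
        a * (a ^ (n + 1) - b ^ (n + 1)) + b ^ (n + 1) * (a - b) := by ring
    rw [e]
    calc ‖a * (a ^ (n + 1) - b ^ (n + 1)) + b ^ (n + 1) * (a - b)‖
        ≤ ‖a‖ * ‖a ^ (n + 1) - b ^ (n + 1)‖ + ‖b‖ ^ (n + 1) * ‖a - b‖ := by
          refine (norm_add_le _ _).trans_eq ?_
          rw [norm_mul, norm_mul, norm_pow]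
      _ ≤ M * ((n + 1) * M ^ n * ‖a - b‖) + M ^ (n + 1) * ‖a - b‖ := by gcongr
      _ = ((n + 1 : ℕ) + 1) * M ^ (n + 1) * ‖a - b‖ := by push_cast; ring

section SchwartzPerturbation

open FourierTransform SchwartzMap

variable {c : ℂ} {S : 𝓢(ℝ, ℂ)} {δ : ℝ}

theorem hasDerivAt_inv_const_add_schwartz (hne : ∀ x, c + S x ≠ 0) (x : ℝ) :
    HasDerivAt (fun x => (c + S x)⁻¹) (-(derivCLM ℂ ℂ S x) * (c + S x)⁻¹ ^ 2) x := by
  have h : HasDerivAt (fun x => c + S x) (derivCLM ℂ ℂ S x) x := (S.hasDerivAt x).const_add c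
  convert! h.inv (hne x) using 1
  rw [inv_pow, div_eq_mul_inv]

/-- Negative powers of a zero-free function `c + S`, with `S` a Schwartz function, are constants
plus Fourier transforms of integrable functions; the norms grow like the supremum norms, up to a
polynomial factor.  This is what makes Newman's series argument converge. -/
theorem isFourierL1_inv_pow_sub (hδ : 0 < δ) (hP : ∀ x, δ ≤ ‖c + S x‖) (hc : δ ≤ ‖c‖) :
    ∃ K : ℝ, ∀ n : ℕ, IsFourierL1 (K * (n + 1) ^ 2 * δ⁻¹ ^ (n + 1))
      (fun x => (c + S x)⁻¹ ^ (n + 1) - c⁻¹ ^ (n + 1)) := by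
  set S₁ := derivCLM ℂ ℂ S
  set S₂ := derivCLM ℂ ℂ S₁
  obtain ⟨B, hB⟩ : ∃ B, ∀ x, ‖S₁ x‖ ≤ B := ⟨_, fun x => norm_le_seminorm ℝ S₁ x⟩
  have hB0 : 0 ≤ B := (norm_nonneg _).trans (hB 0)
  set η := δ⁻¹ with hη
  have hη0 : 0 < η := inv_pos.2 hδ
  have hne : ∀ x, c + S x ≠ 0 := fun x => norm_pos_iff.1 (hδ.trans_le (hP x))
  have hc0 : c ≠ 0 := norm_pos_iff.1 (hδ.trans_le hc)
  have hu : ∀ x, ‖(c + S x)⁻¹‖ ≤ η := fun x => by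
    rw [norm_inv]; exact inv_anti₀ hδ (hP x)
  have hcu : ‖c⁻¹‖ ≤ η := by rw [norm_inv]; exact inv_anti₀ hδ hc
  have hcont : Continuous fun x => (c + S x)⁻¹ :=
    (continuous_const.add S.continuous).inv₀ hne
  have hdu : ∀ x, HasDerivAt (fun x => (c + S x)⁻¹) (-(S₁ x) * (c + S x)⁻¹ ^ 2) x :=
    hasDerivAt_inv_const_add_schwartz hne
  have hdS₁ : ∀ x, HasDerivAt S₁ (S₂ x) x := fun x => S₁.hasDerivAt x
  refine ⟨Real.pi * ((∫ x, η * ‖S x‖) + ∫ x, (η * ‖S₂ x‖ + 2 * η ^ 2 * B * ‖S₁ x‖)), fun n => ?_⟩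
  set h₁ : ℝ → ℂ := fun x => -(n + 1) * (S₁ x * (c + S x)⁻¹ ^ (n + 2)) with hh₁
  set h₂ : ℝ → ℂ := fun x => -(n + 1) * (S₂ x * (c + S x)⁻¹ ^ (n + 2) -
    (n + 2) * (S₁ x * S₁ x * (c + S x)⁻¹ ^ (n + 3))) with hh₂
  have hd : ∀ x, HasDerivAt (fun x => (c + S x)⁻¹ ^ (n + 1) - c⁻¹ ^ (n + 1)) (h₁ x) x := fun x => by
    convert! ((hdu x).pow (n + 1)).sub_const (c⁻¹ ^ (n + 1)) using 1
    simp only [hh₁, Nat.add_sub_cancel]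
    push_cast
    ring
  have hd₁ : ∀ x, HasDerivAt h₁ (h₂ x) x := fun x => by
    convert! ((hdS₁ x).mul ((hdu x).pow (n + 2))).const_mul (-(n + 1 : ℂ)) using 1
    simp only [hh₂, Pi.pow_apply, show n + 2 - 1 = n + 1 from rfl]
    push_cast
    ring
  have b : ∀ x, ‖(c + S x)⁻¹ ^ (n + 1) - c⁻¹ ^ (n + 1)‖ ≤
      (n + 1) ^ 2 * η ^ (n + 1) * (η * ‖S x‖) := fun x => by
    have e : (c + S x)⁻¹ - c⁻¹ = -(S x * (c + S x)⁻¹ * c⁻¹) := by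
      field_simp [hne x]
      ring
    calc _ ≤ (n + 1) * η ^ n * ‖(c + S x)⁻¹ - c⁻¹‖ := norm_pow_sub_pow_le_mul (hu x) hcu n
      _ = (n + 1) * η ^ n * (‖S x‖ * ‖(c + S x)⁻¹‖ * ‖c⁻¹‖) := by
        rw [e, norm_neg, norm_mul, norm_mul]
      _ ≤ (n + 1) * η ^ n * (‖S x‖ * η * η) := by gcongr; exact hu x
      _ = (n + 1) * (η ^ (n + 1) * (η * ‖S x‖)) := by ring
      _ ≤ (n + 1) ^ 2 * (η ^ (n + 1) * (η * ‖S x‖)) := by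
        gcongr
        nlinarith [n.cast_nonneg (α := ℝ)]
      _ = _ := by ring
  have b₁ : ∀ x, ‖h₁ x‖ ≤ (n + 1) * η ^ (n + 2) * ‖S₁ x‖ := fun x => by
    have e : ‖(-(n + 1 : ℂ))‖ = n + 1 := by
      rw [norm_neg]; exact_mod_cast Complex.norm_natCast (n + 1)
    simp only [hh₁, norm_mul, norm_pow, e]
    calc _ ≤ ((n : ℝ) + 1) * (‖S₁ x‖ * η ^ (n + 2)) := by gcongr; exact hu x
      _ = _ := by ring
  have b₂ : ∀ x, ‖h₂ x‖ ≤ (n + 1) ^ 2 * η ^ (n + 1) *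
      (η * ‖S₂ x‖ + 2 * η ^ 2 * B * ‖S₁ x‖) := fun x => by
    have e : ‖(-(n + 1 : ℂ))‖ = n + 1 := by
      rw [norm_neg]; exact_mod_cast Complex.norm_natCast (n + 1)
    have e' : ‖(n + 2 : ℂ)‖ = n + 2 := by exact_mod_cast Complex.norm_natCast (n + 2)
    calc ‖h₂ x‖ ≤ (n + 1) * (‖S₂ x‖ * ‖(c + S x)⁻¹‖ ^ (n + 2) +
          (n + 2) * (‖S₁ x‖ * ‖S₁ x‖ * ‖(c + S x)⁻¹‖ ^ (n + 3))) := by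
          simp only [hh₂]
          rw [norm_mul, e]
          gcongr
          refine (norm_sub_le _ _).trans_eq ?_
          simp only [norm_mul, norm_pow, e']
      _ ≤ (n + 1) * (((n : ℝ) + 1) * (‖S₂ x‖ * η ^ (n + 2)) +
          (2 * (n + 1)) * (B * ‖S₁ x‖ * η ^ (n + 3))) := by
          have t₁ : ‖S₂ x‖ * ‖(c + S x)⁻¹‖ ^ (n + 2) ≤ ((n : ℝ) + 1) * (‖S₂ x‖ * η ^ (n + 2)) := by
            calc _ ≤ ‖S₂ x‖ * η ^ (n + 2) := by gcongr; exact hu x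
              _ ≤ _ := le_mul_of_one_le_left (by positivity) (by simp)
          have t₂ : ‖S₁ x‖ * ‖S₁ x‖ * ‖(c + S x)⁻¹‖ ^ (n + 3) ≤ B * ‖S₁ x‖ * η ^ (n + 3) := by
            gcongr
            exacts [hB x, hu x]
          have t₃ : (n : ℝ) + 2 ≤ 2 * (n + 1) := by linarith [n.cast_nonneg (α := ℝ)]
          exact mul_le_mul_of_nonneg_left (add_le_add t₁ (mul_le_mul t₃ t₂ (by positivity)
            (by positivity))) (by positivity)
      _ = _ := by ring
  have i : Integrable fun x => (n + 1) ^ 2 * η ^ (n + 1) * (η * ‖S x‖) :=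
    (S.integrable.norm.const_mul η).const_mul _
  have i₁ : Integrable fun x => (n + 1) * η ^ (n + 2) * ‖S₁ x‖ :=
    S₁.integrable.norm.const_mul _
  have i₂ : Integrable fun x => (n + 1) ^ 2 * η ^ (n + 1) *
      (η * ‖S₂ x‖ + 2 * η ^ 2 * B * ‖S₁ x‖) :=
    ((S₂.integrable.norm.const_mul η).add (S₁.integrable.norm.const_mul _)).const_mul _
  have hc₁ : Continuous S₁ := S₁.continuous
  have hc₂ : Continuous S₂ := S₂.continuous
  have hi := i.mono' (f := fun x => (c + S x)⁻¹ ^ (n + 1) - c⁻¹ ^ (n + 1))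
    (by fun_prop) (ae_of_all _ b)
  have hi₁ := i₁.mono' (f := h₁) (by fun_prop) (ae_of_all _ b₁)
  have hi₂ := i₂.mono' (f := h₂) (by fun_prop) (ae_of_all _ b₂)
  obtain ⟨hg, hgn, hge⟩ := fourier_fourierInv_of_hasDerivAt hd hd₁ hi hi₁ hi₂
  refine ⟨_, hg, hgn.trans ?_, fun w => (congrFun hge w).symm⟩
  calc _ ≤ Real.pi * ((∫ x, (n + 1) ^ 2 * η ^ (n + 1) * (η * ‖S x‖)) +
        ∫ x, (n + 1) ^ 2 * η ^ (n + 1) * (η * ‖S₂ x‖ + 2 * η ^ 2 * B * ‖S₁ x‖)) := by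
        gcongr Real.pi * (?_ + ?_)
        · exact integral_mono hi.norm i b
        · exact integral_mono hi₂.norm i₂ b₂
    _ = _ := by
        rw [integral_const_mul _ fun x => η * ‖S x‖,
          integral_const_mul _ fun x => η * ‖S₂ x‖ + 2 * η ^ 2 * B * ‖S₁ x‖]
        ring

/-- A zero-free function `c + S`, with `S` a Schwartz function, has a logarithm whose derivative
is the Fourier transform of an integrable function that is Lipschitz at the origin. -/
theorem exists_log_const_add_schwartz (hδ : 0 < δ) (hP : ∀ x, δ ≤ ‖c + S x‖) :
    ∃ (A : ℂ) (r : ℝ → ℂ) (L : ℝ), Integrable r ∧ (∀ x, ‖r x - r 0‖ ≤ L * |x|) ∧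
      Integrable (𝓕 r) ∧ Continuous (𝓕 r) ∧ ∫ t, 𝓕 r t = r 0 ∧
      ∀ w, c + S w = Complex.exp (A + ∫ t in (0)..w, 𝓕 r t) := by
  set S₁ := derivCLM ℂ ℂ S
  set S₂ := derivCLM ℂ ℂ S₁
  set S₃ := derivCLM ℂ ℂ S₂
  obtain ⟨B, hB⟩ : ∃ B, ∀ x, ‖S₁ x‖ ≤ B := ⟨_, fun x => norm_le_seminorm ℝ S₁ x⟩
  have hB0 : 0 ≤ B := (norm_nonneg _).trans (hB 0)
  set η := δ⁻¹ with hη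
  have hη0 : 0 < η := inv_pos.2 hδ
  have hne : ∀ x, c + S x ≠ 0 := fun x => norm_pos_iff.1 (hδ.trans_le (hP x))
  have hu : ∀ x, ‖(c + S x)⁻¹‖ ≤ η := fun x => by
    rw [norm_inv]; exact inv_anti₀ hδ (hP x)
  have hcont : Continuous fun x => (c + S x)⁻¹ :=
    (continuous_const.add S.continuous).inv₀ hne
  have hdu : ∀ x, HasDerivAt (fun x => (c + S x)⁻¹) (-(S₁ x) * (c + S x)⁻¹ ^ 2) x :=
    hasDerivAt_inv_const_add_schwartz hne
  have hdS₁ : ∀ x, HasDerivAt S₁ (S₂ x) x := fun x => S₁.hasDerivAt x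
  have hdS₂ : ∀ x, HasDerivAt S₂ (S₃ x) x := fun x => S₂.hasDerivAt x
  have hc₁ : Continuous S₁ := S₁.continuous
  have hc₂ : Continuous S₂ := S₂.continuous
  have hc₃ : Continuous S₃ := S₃.continuous
  set q : ℝ → ℂ := fun x => S₁ x * (c + S x)⁻¹ with hq
  set q₁ : ℝ → ℂ := fun x => S₂ x * (c + S x)⁻¹ - S₁ x * (S₁ x * (c + S x)⁻¹ ^ 2) with hq₁
  set q₂ : ℝ → ℂ := fun x => S₃ x * (c + S x)⁻¹ - S₂ x * (3 * S₁ x * (c + S x)⁻¹ ^ 2) +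
    S₁ x * (2 * S₁ x ^ 2 * (c + S x)⁻¹ ^ 3) with hq₂
  have hd : ∀ x, HasDerivAt q (q₁ x) x := fun x => by
    convert! (hdS₁ x).mul (hdu x) using 1
    simp only [hq₁]
    ring
  have hd₁ : ∀ x, HasDerivAt q₁ (q₂ x) x := fun x => by
    convert! ((hdS₂ x).mul (hdu x)).sub
      ((hdS₁ x).mul ((hdS₁ x).mul ((hdu x).pow 2))) using 1
    simp only [hq₂, Pi.pow_apply, Pi.mul_apply]
    push_cast
    ring
  have bdd : ∀ (T : 𝓢(ℝ, ℂ)) (v : ℝ → ℂ), Continuous v → (∃ M, ∀ x, ‖v x‖ ≤ M) →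
      Integrable fun x => T x * v x := fun T v hv ⟨M, hM⟩ =>
    T.integrable.mul_bdd (c := M) hv.aestronglyMeasurable (ae_of_all _ hM)
  have iq : Integrable q := bdd S₁ _ hcont ⟨η, hu⟩
  have iq₁ : Integrable q₁ := by
    refine (bdd S₂ _ hcont ⟨η, hu⟩).sub (bdd S₁ _ (by fun_prop) ⟨B * η ^ 2, fun x => ?_⟩)
    rw [norm_mul, norm_pow]
    gcongr
    exacts [hB x, hu x]
  have iq₂ : Integrable q₂ := by
    refine ((bdd S₃ _ hcont ⟨η, hu⟩).sub (bdd S₂ _ (by fun_prop) ⟨3 * B * η ^ 2, fun x => ?_⟩)).add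
      (bdd S₁ _ (by fun_prop) ⟨2 * B ^ 2 * η ^ 3, fun x => ?_⟩)
    · simp only [norm_mul, norm_pow, Complex.norm_ofNat]
      gcongr
      exacts [hB x, hu x]
    · simp only [norm_mul, norm_pow, Complex.norm_ofNat]
      gcongr
      exacts [hB x, hu x]
  have ixq : Integrable fun x : ℝ => x • q x := by
    have h1 : Integrable fun x : ℝ => η * (‖x‖ ^ 1 * ‖S₁ x‖) :=
      (S₁.integrable_pow_mul volume 1).const_mul η
    have hqc : Continuous q := hc₁.mul hcont
    refine h1.mono' (by fun_prop) (ae_of_all _ fun x => ?_)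
    simp only [hq, norm_smul, norm_mul, pow_one]
    calc _ ≤ ‖x‖ * (‖S₁ x‖ * η) := by gcongr; exact hu x
      _ = _ := by ring
  obtain ⟨hr, -, hrq⟩ := fourier_fourierInv_of_hasDerivAt hd hd₁ iq iq₁ iq₂
  have hinv : 𝓕⁻ q = fun x => 𝓕 q (-x) := by
    ext x
    exact Real.fourierInv_eq_fourier_neg q x
  have hqc : Continuous q := hc₁.mul hcont
  set Q : ℝ → ℂ := fun w => ∫ t in (0)..w, q t
  have hQ : ∀ w, HasDerivAt Q (q w) w := fun w =>
    intervalIntegral.integral_hasDerivAt_right (hqc.intervalIntegrable _ _)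
      (hqc.stronglyMeasurableAtFilter _ _) hqc.continuousAt
  -- `Q` is a primitive of the logarithmic derivative, so `(c + S) e^{-Q}` is constant
  have hconst : ∀ w, (c + S w) * Complex.exp (-Q w) = c + S 0 := by
    have hder : ∀ w, HasDerivAt (fun w => (c + S w) * Complex.exp (-Q w)) 0 w := fun w => by
      convert! ((S.hasDerivAt w).const_add c).mul (hQ w).neg.cexp using 1
      have : q w * (c + S w) = deriv S w := by
        simp only [hq]
        rw [mul_assoc, inv_mul_cancel₀ (hne w), mul_one]
        rfl
      linear_combination Complex.exp (-Q w) * this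
    intro w
    have := is_const_of_deriv_eq_zero (fun w => (hder w).differentiableAt)
      (fun w => (hder w).deriv) w 0
    simpa [Q] using this
  refine ⟨Complex.log (c + S 0), 𝓕⁻ q, ∫ x : ℝ, ‖(-2 * Real.pi * Complex.I * x) • q x‖, hr,
    fun x => ?_, by rwa [hrq], by rwa [hrq], ?_, fun w => ?_⟩
  · have hdF := Real.hasDerivAt_fourier iq ixq
    have hle : ∀ w, ‖𝓕 (fun x : ℝ => (-2 * Real.pi * Complex.I * x) • q x) w‖ ≤
        ∫ x : ℝ, ‖(-2 * Real.pi * Complex.I * x) • q x‖ := fun w =>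
      VectorFourier.norm_fourierIntegral_le_integral_norm _ _ _ _ _
    have := Convex.norm_image_sub_le_of_norm_hasDerivWithin_le (s := Set.univ)
      (fun w _ => (hdF w).hasDerivWithinAt) (fun w _ => hle w) convex_univ
      (Set.mem_univ 0) (Set.mem_univ (-x))
    simpa [hinv] using this
  · rw [hrq, Real.fourierInv_eq]
    simp
  · rw [hrq, Complex.exp_add, Complex.exp_log (hne 0), ← hconst w, mul_assoc, ← Complex.exp_add]
    simp [Q]

end SchwartzPerturbation

/-! ### A Wiener–Lévy theorem for curves with non-zero winding -/

theorem exists_pos_le_norm_of_tendsto_cocompact {F : ℝ → ℂ} {c : ℂ} (hF : Continuous F)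
    (hne : ∀ w, F w ≠ 0) (hc : c ≠ 0) (hlim : Tendsto F (cocompact ℝ) (𝓝 c)) :
    ∃ δ : ℝ, 0 < δ ∧ δ ≤ ‖c‖ ∧ ∀ w, δ ≤ ‖F w‖ := by
  have hcp : 0 < ‖c‖ := norm_pos_iff.2 hc
  have hev : ∀ᶠ w in cocompact ℝ, ‖c‖ / 2 < ‖F w‖ := hlim.norm.eventually_const_lt (by linarith)
  obtain ⟨K, hK, hKs⟩ := mem_cocompact.1 hev
  rcases K.eq_empty_or_nonempty with rfl | hne'
  · exact ⟨‖c‖ / 2, by positivity, by linarith, fun w => (hKs (Set.notMem_empty w)).le⟩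
  · obtain ⟨x, -, hx⟩ := hK.exists_isMinOn hne' hF.norm.continuousOn
    have hxp : 0 < ‖F x‖ := norm_pos_iff.2 (hne x)
    refine ⟨min (‖c‖ / 2) ‖F x‖, by positivity, (min_le_left _ _).trans (by linarith),
      fun w => ?_⟩
    by_cases hw : w ∈ K
    · exact (min_le_right _ _).trans (hx hw)
    · exact (min_le_left _ _).trans (hKs hw).le

open FourierTransform in
/-- A **Wiener–Lévy theorem** with winding.  A zero-free function `c + 𝓕 k` with `c ≠ 0` and `k`
integrable has a logarithm that is the sum of a constant, of a primitive of `𝓕 r` with `r`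
integrable and Lipschitz at the origin, and of the Fourier transform of an integrable function.  The
number `r 0 = ∫ 𝓕 r` carries the winding of the curve. -/
theorem exists_log_const_add_fourier {c : ℂ} {k : ℝ → ℂ} (hk : Integrable k) (hc : c ≠ 0)
    (hne : ∀ w, c + 𝓕 k w ≠ 0) :
    ∃ (A : ℂ) (r g : ℝ → ℂ) (L : ℝ), Integrable r ∧ (∀ x, ‖r x - r 0‖ ≤ L * |x|) ∧
      Integrable (𝓕 r) ∧ Continuous (𝓕 r) ∧ ∫ t, 𝓕 r t = r 0 ∧ Integrable g ∧
      ∀ w, c + 𝓕 k w = Complex.exp (A + (∫ t in (0)..w, 𝓕 r t) + 𝓕 g w) := by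
  have hFc : Continuous (𝓕 k) :=
    VectorFourier.fourierIntegral_continuous Real.continuous_fourierChar (by fun_prop) hk
  obtain ⟨δ₀, hδ₀, hδc, hδF⟩ := exists_pos_le_norm_of_tendsto_cocompact
    (F := fun w => c + 𝓕 k w) (by fun_prop) hne hc
    (by simpa using (Real.zero_at_infty_fourier k).const_add c)
  obtain ⟨ε, hε, rfl⟩ : ∃ ε, 0 < ε ∧ δ₀ = 3 * ε := ⟨δ₀ / 3, by positivity, by ring⟩
  -- approximate `k` in `L¹` by a test function `s`; the quotient of `c + 𝓕 k` by `c + 𝓕 s` is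
  -- then so close to `1` that the logarithmic series converges in the Wiener algebra
  obtain ⟨s, hs, hs', hsk⟩ :=
    (memLp_one_iff_integrable.2 hk).exist_eLpNorm_sub_le ENNReal.one_ne_top le_rfl hε
  set S₀ : SchwartzMap ℝ ℂ := hs.toSchwartzMap hs'
  set S : SchwartzMap ℝ ℂ := 𝓕 S₀
  have hS : ∀ w, S w = 𝓕 s w := fun w => rfl
  have hsi : Integrable s := S₀.integrable
  set D : ℝ → ℂ := fun w => 𝓕 k w - S w with hD
  have hD1 : IsFourierL1 ε D := by
    refine ⟨k - s, hk.sub hsi, ?_, fun w => ?_⟩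
    · rw [← ENNReal.ofReal_le_ofReal_iff hε.le, ofReal_integral_norm_eq_lintegral_enorm
        (hk.sub hsi), ← eLpNorm_one_eq_lintegral_enorm]
      exact hsk
    · simp only [hD, hS]
      rw [Real.fourier_eq, Real.fourier_eq, Real.fourier_eq,
        ← integral_sub ((Real.fourierIntegral_convergent_iff w).2 hk)
          ((Real.fourierIntegral_convergent_iff w).2 hsi)]
      simp only [Pi.sub_apply, smul_sub]
  have hDle : ∀ w, ‖D w‖ ≤ ε := fun w => by
    obtain ⟨g, -, hgC, hg⟩ := hD1
    rw [hg]
    exact (VectorFourier.norm_fourierIntegral_le_integral_norm _ _ _ _ _).trans hgC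
  have hPD : ∀ w, c + 𝓕 k w = (c + S w) + D w := fun w => by simp only [hD]; ring
  have hP : ∀ w, 2 * ε ≤ ‖c + S w‖ := fun w => by
    have h1 := hδF w
    simp only [hPD] at h1
    linarith [norm_add_le (c + S w) (D w), hDle w]
  have h2ε : 0 < 2 * ε := by positivity
  have hPne : ∀ w, c + S w ≠ 0 := fun w => norm_pos_iff.1 (h2ε.trans_le (hP w))
  obtain ⟨A, r, L, hr, hrL, hrF, hrFc, hr0, hexp⟩ := exists_log_const_add_schwartz h2ε hP
  obtain ⟨K, hK⟩ := isFourierL1_inv_pow_sub h2ε hP (c := c) (S := S) (by linarith)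
  have hcu : ‖c⁻¹‖ ≤ (2 * ε)⁻¹ := by
    rw [norm_inv]; exact inv_anti₀ h2ε (by linarith)
  have hhalf : ε * (2 * ε)⁻¹ = 1 / 2 := by field_simp
  have hterm : ∀ n : ℕ, IsFourierL1 ((1 / 2) ^ (n + 1) + K * ((n + 1) ^ 2 * (1 / 2) ^ (n + 1)))
      (fun w => (-1) ^ (n + 1 + 1) / (n + 1 : ℂ) *
        (c⁻¹ ^ (n + 1) * D w ^ (n + 1) +
          D w ^ (n + 1) * ((c + S w)⁻¹ ^ (n + 1) - c⁻¹ ^ (n + 1)))) := fun n => by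
    have h1 := ((hD1.pow_succ n).const_mul (c⁻¹ ^ (n + 1))).add ((hD1.pow_succ n).mul (hK n))
    refine (h1.const_mul ((-1) ^ (n + 1 + 1) / (n + 1 : ℂ))).mono ?_
    have e : ‖((-1) ^ (n + 1 + 1) / (n + 1 : ℂ))‖ ≤ 1 := by
      have : ‖(n + 1 : ℂ)‖ = n + 1 := by exact_mod_cast Complex.norm_natCast (n + 1)
      rw [norm_div, norm_pow, norm_neg, norm_one, one_pow, this]
      exact div_le_one_of_le₀ (by simp) (by positivity)
    refine (mul_le_of_le_one_left h1.nonneg e).trans ?_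
    rw [← hhalf, mul_pow, norm_pow]
    have : ‖c⁻¹‖ ^ (n + 1) * ε ^ (n + 1) ≤ (2 * ε)⁻¹ ^ (n + 1) * ε ^ (n + 1) := by gcongr
    linarith
  have hsum : Summable fun n : ℕ =>
      (1 / 2 : ℝ) ^ (n + 1) + K * ((n + 1) ^ 2 * (1 / 2) ^ (n + 1)) := by
    have h1 := summable_pow_mul_geometric_of_norm_lt_one (R := ℝ) 2 (r := 1 / 2) (by norm_num)
    have h2 := (summable_nat_add_iff 1).2 h1
    have h3 := (summable_nat_add_iff 1).2 summable_geometric_two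
    refine h3.add ((Summable.congr h2 fun n => ?_).mul_left K)
    push_cast
    rfl
  obtain ⟨g, hg, hlog⟩ := IsFourierL1.of_hasSum (Φ := fun w => Complex.log (1 + D w * (c + S w)⁻¹))
    hterm hsum fun w => by
      have hw : ‖D w * (c + S w)⁻¹‖ < 1 := by
        rw [norm_mul, norm_inv, ← div_eq_mul_inv, div_lt_one (h2ε.trans_le (hP w))]
        linarith [hDle w, hP w]
      have h1 := (hasSum_nat_add_iff' 1).2 (Complex.hasSum_taylorSeries_log hw)
      simp only [Finset.range_one, Finset.sum_singleton, Nat.cast_zero, div_zero, sub_zero] at h1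
      convert! h1 using 2 with n
      rw [mul_pow]
      push_cast
      ring
  refine ⟨A, r, g, L, hr, hrL, hrF, hrFc, hr0, hg, fun w => ?_⟩
  have h1 : 1 + D w * (c + S w)⁻¹ ≠ 0 := fun h0 => hne w <| by
    rw [hPD]
    have := congrArg (fun t => (c + S w) * t) h0
    simp only [mul_zero] at this
    rw [← this]
    field_simp [hPne w]
  rw [Complex.exp_add, ← hlog, Complex.exp_log h1, ← hexp, hPD]
  field_simp [hPne w]

/-! ### The index and the Lévy–Khintchine density -/

theorem integrable_exp_neg_abs : Integrable fun x : ℝ => Real.exp (-|x|) := by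
  rw [← integrableOn_univ, ← Set.Iic_union_Ioi (a := (0 : ℝ)), integrableOn_union]
  constructor
  · refine (integrableOn_exp_Iic 0).congr_fun (fun x hx => ?_) measurableSet_Iic
    simp [abs_of_nonpos (Set.mem_Iic.1 hx)]
  · refine (integrableOn_exp_neg_Ioi 0).congr_fun (fun x hx => ?_) measurableSet_Ioi
    simp [abs_of_pos (Set.mem_Ioi.1 hx)]

/-- Continuous logarithms of the same function that agree at `0` agree everywhere. -/
theorem eq_of_exp_eq_of_continuous {u v : ℝ → ℂ} (hu : Continuous u) (hv : Continuous v)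
    (h0 : u 0 = v 0) (h : ∀ z, Complex.exp (u z) = Complex.exp (v z)) : u = v := by
  have hn : ∀ z, ∃ n : ℤ, (u z - v z) / (2 * Real.pi * Complex.I) = n := fun z => by
    obtain ⟨n, hn⟩ := Complex.exp_eq_exp_iff_exists_int.1 (h z)
    refine ⟨n, ?_⟩
    rw [div_eq_iff Complex.two_pi_I_ne_zero, hn]
    ring
  choose n hn using hn
  have hc : Continuous n := by
    rw [Int.isClosedEmbedding_coe_real.isEmbedding.continuous_iff]
    have : (fun k : ℤ => (k : ℝ)) ∘ n = fun z => ((u z - v z) / (2 * Real.pi * Complex.I)).re := by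
      ext z
      simp [hn z]
    rw [this]
    fun_prop
  ext z
  have hz : n z = n 0 := PreconnectedSpace.constant inferInstance hc
  have e := hn z
  rw [hz, ← hn 0, h0, sub_self, zero_div, div_eq_zero_iff] at e
  exact sub_eq_zero.1 (e.resolve_right Complex.two_pi_I_ne_zero)

open FourierTransform in
theorem fourier_neg_div_two_pi (f : ℝ → ℂ) (z : ℝ) :
    𝓕 f (-z / (2 * Real.pi)) = ∫ x : ℝ, Complex.exp (Complex.I * x * z) * f x := by
  rw [Real.fourier_real_eq_integral_exp_smul]
  congr 1 with x
  rw [smul_eq_mul]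
  congr 2
  push_cast
  field_simp [Complex.ofReal_ne_zero.2 Real.pi_ne_zero]

open FourierTransform in
/-- A primitive of a Fourier transform `𝓕 r` is a Lévy–Khintchine integral, without compensation,
with density proportional to `r x / x`. -/
theorem intervalIntegral_fourier_eq {r : ℝ → ℂ} (hr : Integrable r) (z : ℝ) :
    ∫ t in (0)..(-z / (2 * Real.pi)), 𝓕 r t =
      ∫ x : ℝ, (Complex.exp (Complex.I * x * z) - 1) * (Complex.I / (2 * Real.pi * x) * r x) := by
  simp_rw [Real.fourier_real_eq_integral_exp_smul]
  rw [intervalIntegral_integral_swap]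
  · refine integral_congr_ae ?_
    filter_upwards [Measure.ae_ne volume (0 : ℝ)] with x hx
    have hx' : (x : ℂ) ≠ 0 := Complex.ofReal_ne_zero.2 hx
    have hpi : (Real.pi : ℂ) ≠ 0 := Complex.ofReal_ne_zero.2 Real.pi_ne_zero
    have hc : -(2 * Real.pi * x * Complex.I) ≠ 0 :=
      neg_ne_zero.2 (mul_ne_zero (mul_ne_zero (by simp) hx') Complex.I_ne_zero)
    have e : ∀ t : ℝ, Complex.exp (↑(-2 * Real.pi * x * t) * Complex.I) • r x =
        Complex.exp (-(2 * Real.pi * x * Complex.I) * t) * r x := fun t => by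
      rw [smul_eq_mul]
      congr 2
      push_cast
      ring
    simp_rw [e]
    rw [intervalIntegral.integral_mul_const, integral_exp_mul_complex hc]
    have e' : -(2 * Real.pi * x * Complex.I) * ((-z / (2 * Real.pi) : ℝ) : ℂ) =
        Complex.I * x * z := by
      push_cast
      field_simp
    rw [e', Complex.ofReal_zero, mul_zero, Complex.exp_zero, div_mul_eq_mul_div, mul_comm _ (r x),
      div_eq_iff hc]
    field_simp
    rw [Complex.I_sq]
    ring
  · have : IsFiniteMeasure (volume.restrict (Set.uIoc 0 (-z / (2 * Real.pi)))) := by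
      rw [Set.uIoc]; infer_instance
    have : Integrable (Function.uncurry fun (_ : ℝ) (x : ℝ) => r x)
        ((volume.restrict (Set.uIoc 0 (-z / (2 * Real.pi)))).prod volume) := hr.comp_snd _
    refine this.mono ?_ (ae_of_all _ fun p => ?_)
    · have h1 : Continuous fun p : ℝ × ℝ =>
        Complex.exp (↑(-2 * Real.pi * p.2 * p.1) * Complex.I) := by fun_prop
      exact h1.aestronglyMeasurable.smul this.1
    · simp [Function.uncurry, Complex.norm_exp]

theorem indexDensity_eq (g : ℝ → ℝ) (m x : ℝ) :
    indexDensity g m x = g x + m * (Real.exp (-|x|) / x) := by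
  rw [indexDensity]
  rcases lt_trichotomy x 0 with hx | rfl | hx
  · simp only [Set.indicator, Set.mem_Ioi, Set.mem_Iio, hx, hx.le.not_gt, if_true, if_false,
      abs_of_neg hx]
    field_simp
    ring
  · simp
  · simp only [Set.indicator, Set.mem_Ioi, Set.mem_Iio, hx, hx.le.not_gt, if_true, if_false,
      abs_of_pos hx]
    ring

theorem measurable_indexDensity {g : ℝ → ℝ} (hg : Measurable g) (m : ℝ) :
    Measurable (indexDensity g m) := by
  simp_rw [funext (indexDensity_eq g m)]
  fun_prop

theorem norm_exp_sub_one_le (x z : ℝ) : ‖Complex.exp (Complex.I * x * z) - 1‖ ≤ |z| * |x| := by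
  have := Real.norm_exp_I_mul_ofReal_sub_one_le (x := x * z)
  rw [Complex.ofReal_mul, ← mul_assoc, Real.norm_eq_abs, abs_mul, mul_comm |x|] at this
  exact this

theorem norm_exp_eq_one (x z : ℝ) : ‖Complex.exp (Complex.I * x * z)‖ = 1 := by
  simp [Complex.norm_exp]

theorem norm_exp_sub_one_le_two (x z : ℝ) : ‖Complex.exp (Complex.I * x * z) - 1‖ ≤ 2 := by
  refine (norm_sub_le _ _).trans ?_
  rw [norm_exp_eq_one, norm_one]
  norm_num

/-- The two-sided density `e^{-|x|} / x` integrates functions that are `O(|x|)`. -/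
theorem integrable_mul_exp_neg_abs_div {φ : ℝ → ℂ} (hφ : Measurable φ) {C : ℝ}
    (h : ∀ x, ‖φ x‖ ≤ C * |x|) :
    Integrable fun x : ℝ => φ x * ((Real.exp (-|x|) / x : ℝ) : ℂ) := by
  refine (integrable_exp_neg_abs.const_mul C).mono' (by fun_prop) (ae_of_all _ fun x => ?_)
  rw [norm_mul, Complex.norm_real, norm_div, Real.norm_eq_abs, Real.norm_eq_abs, Real.abs_exp]
  rcases eq_or_ne x 0 with rfl | hx
  · have := (norm_nonneg _).trans (h 1)
    simp only [abs_one, mul_one] at this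
    simpa using this
  · have hx' : 0 < |x| := abs_pos.2 hx
    calc _ ≤ C * |x| * (Real.exp (-|x|) / |x|) := by gcongr; exact h x
      _ = _ := by field_simp

theorem integrable_mul_indexDensity {g : ℝ → ℝ} (hg : Integrable g) (m : ℝ) {φ : ℝ → ℂ}
    (hφ : Measurable φ) {B C : ℝ} (hB : ∀ x, ‖φ x‖ ≤ B) (hC : ∀ x, ‖φ x‖ ≤ C * |x|) :
    Integrable fun x : ℝ => φ x * (indexDensity g m x : ℂ) := by
  have h1 : Integrable fun x : ℝ => φ x * (g x : ℂ) :=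
    hg.ofReal.bdd_mul (c := B) hφ.aestronglyMeasurable (ae_of_all _ hB)
  have h2 := (integrable_mul_exp_neg_abs_div hφ hC).const_mul (m : ℂ)
  refine (h1.add h2).congr (ae_of_all _ fun x => ?_)
  simp only [Pi.add_apply, indexDensity_eq]
  push_cast
  ring

/-- Dividing by `x` keeps integrability when the function is Lipschitz at its zero `0`. -/
theorem integrable_div_of_lipschitz_zero {N : ℝ → ℂ} {L : ℝ} (hN : Integrable N)
    (h : ∀ x, ‖N x‖ ≤ L * |x|) : Integrable fun x : ℝ => N x / x := by
  have hL : 0 ≤ L := by simpa using (norm_nonneg _).trans (h 1)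
  have h1 : Integrable ((Set.Icc (-1) 1).indicator fun _ : ℝ => L) :=
    (integrable_indicator_iff measurableSet_Icc).2 (by simp)
  refine (h1.add hN.norm).mono' ?_ (ae_of_all _ fun x => ?_)
  · simp_rw [div_eq_mul_inv]
    exact hN.1.mul (by fun_prop)
  · rw [norm_div, Complex.norm_real, Real.norm_eq_abs, Pi.add_apply]
    by_cases hx : |x| ≤ 1
    · rw [Set.indicator_of_mem (Set.mem_Icc.2 (abs_le.1 hx))]
      refine le_add_of_le_of_nonneg (div_le_of_le_mul₀ (abs_nonneg x) hL (h x)) (norm_nonneg _)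
    · rw [Set.indicator_of_notMem fun h' => hx (abs_le.2 (Set.mem_Icc.1 h')), zero_add]
      exact div_le_self (norm_nonneg _) (not_le.1 hx).le

theorem abs_one_sub_exp_neg_abs_le (x : ℝ) : |1 - Real.exp (-|x|)| ≤ |x| := by
  rw [abs_of_nonneg (by simp)]
  linarith [Real.add_one_le_exp (-|x|)]

open FourierTransform in
theorem continuous_fourier_of_integrable {f : ℝ → ℂ} (hf : Integrable f) : Continuous (𝓕 f) :=
  VectorFourier.fourierIntegral_continuous Real.continuous_fourierChar (by fun_prop) hf

open FourierTransform in
/-- If `F` is a zero-free function of the form `c + ∫ e^{ixz} k(x) dx` with `c ≠ 0`, normalized and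
Hermitian, then its index `m` exists, is an integer, and `F` is the exponential of a
Lévy–Khintchine integral whose density is integrable up to the singular part carrying `m`. -/
theorem exists_index_and_density {c : ℂ} {k : ℝ → ℂ} (hk : Integrable k) (hc : c ≠ 0) {F : ℝ → ℂ}
    (hF : ∀ z, F z = c + 𝓕 k (-z / (2 * Real.pi))) (hne : ∀ z, F z ≠ 0) (h0 : F 0 = 1)
    (hconj : ∀ z, F (-z) = starRingEnd ℂ (F z)) :
    ∃ (m : ℤ) (g : ℝ → ℝ), HasIndex F m ∧ Measurable g ∧ Integrable g ∧
      ∀ z, F z = Complex.exp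
        (∫ x : ℝ, (Complex.exp (Complex.I * x * z) - 1) * (indexDensity g m x : ℂ)) := by
  have hpi := Real.pi_pos
  obtain ⟨A, r, g, L, hr, hrL, hrF, hrFc, hr0, hg, hexp⟩ :=
    exists_log_const_add_fourier hk hc fun w => by
      have h := hne (-(2 * Real.pi * w))
      rw [hF] at h
      convert! h using 3
      field_simp
  have hgc := continuous_fourier_of_integrable hg
  set J : ℝ → ℂ := fun w => ∫ t in (0)..w, 𝓕 r t with hJ
  have hJc : Continuous J := intervalIntegral.continuous_primitive
    (fun a b => hrFc.intervalIntegrable a b) 0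
  set u : ℝ → ℂ := fun w => A + J w + 𝓕 g w with hu
  have hFu : ∀ z, F z = Complex.exp (u (-z / (2 * Real.pi))) := fun z => by rw [hF, hexp]
  set J₁ := ∫ t in Set.Ioi (0 : ℝ), 𝓕 r t
  set J₂ := ∫ t in Set.Iic (0 : ℝ), 𝓕 r t
  have hJ₁ : Tendsto u atTop (𝓝 (A + J₁)) := by
    have h1 := intervalIntegral_tendsto_integral_Ioi (0 : ℝ) hrF.integrableOn tendsto_id
    have h2 := (Real.zero_at_infty_fourier g).mono_left atTop_le_cocompact
    simpa using (h1.const_add A).add h2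
  have hJ₂ : Tendsto u atBot (𝓝 (A - J₂)) := by
    have h1 := intervalIntegral_tendsto_integral_Iic (0 : ℝ) hrF.integrableOn tendsto_id
    have h2 := (Real.zero_at_infty_fourier g).mono_left atBot_le_cocompact
    have h3 := (h1.neg.const_add A).add h2
    simp only [← intervalIntegral.integral_symm, add_zero, ← sub_eq_add_neg] at h3
    exact h3
  have hJr : J₁ + J₂ = r 0 := by
    rw [← hr0, add_comm, ← setIntegral_union (by simp) measurableSet_Ioi
      hrF.integrableOn hrF.integrableOn, Set.Iic_union_Ioi, setIntegral_univ]
  have hlim : ∀ l : Filter ℝ, l ≤ cocompact ℝ →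
      Tendsto (fun w => Complex.exp (u w)) l (𝓝 c) := fun l hl => by
    have h1 := ((Real.zero_at_infty_fourier k).mono_left hl).const_add c
    simpa only [hexp, add_zero] using h1
  -- both ends of the curve tend to `c`, so the increment of the logarithm is a period of `exp`
  have hperiod : Complex.exp (r 0) = 1 := by
    have e₁ := tendsto_nhds_unique (hlim _ atTop_le_cocompact)
      ((Complex.continuous_exp.tendsto _).comp hJ₁)
    have e₂ := tendsto_nhds_unique (hlim _ atBot_le_cocompact)
      ((Complex.continuous_exp.tendsto _).comp hJ₂)
    rw [← hJr, show J₁ + J₂ = (A + J₁) - (A - J₂) by ring, Complex.exp_sub, ← e₁, ← e₂,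
      div_self hc]
  obtain ⟨n, hn⟩ := Complex.exp_eq_one_iff.1 hperiod
  obtain ⟨m, rfl⟩ : ∃ m : ℤ, n = -m := ⟨-n, by ring⟩
  have hindex : HasIndex F m := by
    -- `z → ∞` corresponds to `w = -z / (2π) → -∞`, hence the order of the two limits
    refine ⟨fun z => (u (-z / (2 * Real.pi))).im, by fun_prop, fun z => ?_, (A + J₁).im,
      (A - J₂).im, ?_, ?_, ?_⟩
    · rw [hFu, Complex.norm_exp, Complex.ofReal_exp, ← Complex.exp_sub]
      congr 1
      apply Complex.ext <;> simp
    · refine (Complex.continuous_im.tendsto _).comp (hJ₁.comp ?_)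
      exact tendsto_neg_atBot_atTop.atTop_div_const (by positivity)
    · refine (Complex.continuous_im.tendsto _).comp (hJ₂.comp ?_)
      exact tendsto_neg_atTop_atBot.atBot_div_const (by positivity)
    · have e : (A - J₂).im - (A + J₁).im = -(r 0).im := by
        rw [← hJr]
        simp only [Complex.sub_im, Complex.add_im]
        ring
      rw [e, hn]
      simp
      field_simp
  -- the complex density, up to the singular part
  set h : ℝ → ℂ := fun x => ((Real.exp (-|x|) / x : ℝ) : ℂ) with hh
  set G : ℝ → ℂ := fun x =>
    Complex.I / (2 * Real.pi) * ((r x - r 0 * (Real.exp (-|x|) : ℝ)) / x) + g x with hG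
  have hGi : Integrable G := by
    refine ((integrable_div_of_lipschitz_zero (L := L + ‖r 0‖)
      (hr.sub (integrable_exp_neg_abs.ofReal.const_mul (r 0))) fun x => ?_).const_mul _).add hg
    have e : r x - r 0 * (Real.exp (-|x|) : ℝ) =
        (r x - r 0) + r 0 * ((1 - Real.exp (-|x|) : ℝ) : ℂ) := by push_cast; ring
    simp only [Pi.sub_apply, RCLike.ofReal_eq_complex_ofReal] 
    rw [e]
    refine (norm_add_le _ _).trans ?_
    rw [norm_mul, Complex.norm_real, Real.norm_eq_abs, add_mul]
    exact add_le_add (hrL x)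
      (mul_le_mul_of_nonneg_left (abs_one_sub_exp_neg_abs_le x) (norm_nonneg _))
  have hGh : ∀ x, G x + m * h x = Complex.I / (2 * Real.pi * x) * r x + g x := fun x => by
    simp only [hG, hh, hn]
    rcases eq_or_ne x 0 with rfl | hx
    · simp
    · have hx' : (x : ℂ) ≠ 0 := Complex.ofReal_ne_zero.2 hx
      have hpi' : (Real.pi : ℂ) ≠ 0 := Complex.ofReal_ne_zero.2 hpi.ne'
      push_cast
      field_simp
      ring_nf
      simp only [Complex.I_sq]
      ring
  have hEm : ∀ z : ℝ, Measurable fun x : ℝ => Complex.exp (Complex.I * x * z) - 1 := fun z => by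
    fun_prop
  have hbdd : ∀ (f : ℝ → ℂ), Integrable f → ∀ z : ℝ,
      Integrable fun x : ℝ => (Complex.exp (Complex.I * x * z) - 1) * f x := fun f hf z =>
    hf.bdd_mul (c := 2) (hEm z).aestronglyMeasurable
      (ae_of_all _ fun x => norm_exp_sub_one_le_two x z)
  have hEh : ∀ z : ℝ, Integrable fun x : ℝ => (Complex.exp (Complex.I * x * z) - 1) * h x :=
    fun z => integrable_mul_exp_neg_abs_div (hEm z) fun x => norm_exp_sub_one_le x z
  have hEr : ∀ z : ℝ, Integrable fun x : ℝ => (Complex.exp (Complex.I * x * z) - 1) *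
      (Complex.I / (2 * Real.pi * x) * r x) := fun z => by
    refine (((hbdd G hGi z).add ((hEh z).const_mul (m : ℂ))).sub (hbdd g hg z)).congr
      (ae_of_all _ fun x => ?_)
    simp only [Pi.add_apply, Pi.sub_apply]
    linear_combination (Complex.exp (Complex.I * x * z) - 1) * hGh x
  set Ψ : ℝ → ℂ := fun z => ∫ x : ℝ, (Complex.exp (Complex.I * x * z) - 1) * (G x + m * h x) with hΨ
  have hΨu : ∀ z, Ψ z = u (-z / (2 * Real.pi)) - u 0 := fun z => by
    have e1 : u (-z / (2 * Real.pi)) - u 0 =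
        J (-z / (2 * Real.pi)) + (𝓕 g (-z / (2 * Real.pi)) - 𝓕 g 0) := by
      simp only [hu, hJ, intervalIntegral.integral_same]
      ring
    have e2 : 𝓕 g 0 = ∫ x, g x := by simp [Real.fourier_eq]
    rw [e1]
    simp only [hJ]
    rw [intervalIntegral_fourier_eq hr, fourier_neg_div_two_pi, e2,
      ← integral_sub _ hg, ← integral_add (hEr z)]
    · simp only [hΨ, hGh]
      congr 1 with x
      ring
    · refine (hbdd g hg z).congr (ae_of_all _ fun x => ?_)
      simp only
      ring
    · refine ((hbdd g hg z).add hg).congr (ae_of_all _ fun x => ?_)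
      simp only [Pi.add_apply]
      ring
  have hu0 : Complex.exp (u 0) = 1 := by simpa [h0] using (hFu 0).symm
  have hFΨ : ∀ z, F z = Complex.exp (Ψ z) := fun z => by
    rw [hΨu, Complex.exp_sub, hu0, div_one, hFu]
  have hΨc : Continuous Ψ := by
    rw [funext hΨu]
    fun_prop
  -- `F` is Hermitian, hence so is its logarithm, and only the real part of the density matters
  have hΨconj : (fun z => starRingEnd ℂ (Ψ (-z))) = Ψ := by
    refine eq_of_exp_eq_of_continuous (by fun_prop) hΨc (by simp [hΨ]) fun z => ?_
    rw [Complex.exp_conj, ← hFΨ, ← hFΨ, hconj, Complex.conj_conj]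
  have hre : ∀ z, Ψ z = ∫ x : ℝ, (Complex.exp (Complex.I * x * z) - 1) *
      (((G x).re + m * (Real.exp (-|x|) / x) : ℝ) : ℂ) := fun z => by
    have e1 : Ψ z = ∫ x : ℝ, (Complex.exp (Complex.I * x * z) - 1) *
        (starRingEnd ℂ (G x) + m * h x) := by
      rw [← congrFun hΨconj z, hΨ]
      simp only
      rw [← integral_conj]
      congr 1 with x
      simp only [hh, map_mul, map_add, map_sub, ← Complex.exp_conj, Complex.conj_I,
        Complex.conj_ofReal, map_one, map_intCast, Complex.ofReal_neg, map_neg]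
      congr 3
      ring
    have i1 := (hbdd G hGi z).add ((hEh z).const_mul (m : ℂ))
    have i2 := (hbdd (fun x => starRingEnd ℂ (G x))
      (hGi.congr' (by fun_prop) (by simp)) z).add ((hEh z).const_mul (m : ℂ))
    have e2 : Ψ z + Ψ z = ∫ x : ℝ, 2 * ((Complex.exp (Complex.I * x * z) - 1) *
      (((G x).re + m * (Real.exp (-|x|) / x) : ℝ) : ℂ)) := by
      nth_rw 2 [e1]
      rw [hΨ]
      simp only
      rw [← integral_add]
      · congr 1 with x
        have := Complex.add_conj (G x)
        simp only [hh]
        push_cast at this ⊢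
        linear_combination (Complex.exp (Complex.I * x * z) - 1) * this
      · refine i1.congr (ae_of_all _ fun x => ?_)
        simp only [Pi.add_apply]
        ring
      · refine i2.congr (ae_of_all _ fun x => ?_)
        simp only [Pi.add_apply]
        ring
    rw [integral_const_mul, ← two_mul] at e2
    exact mul_left_cancel₀ two_ne_zero e2
  have hGre : AEStronglyMeasurable (fun x => (G x).re) := hGi.re.1
  refine ⟨m, hGre.mk, hindex, hGre.stronglyMeasurable_mk.measurable,
    hGi.re.congr hGre.ae_eq_mk, fun z => ?_⟩
  rw [hFΨ, hre]
  congr 1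
  refine integral_congr_ae ?_
  filter_upwards [hGre.ae_eq_mk] with x hx
  rw [indexDensity_eq, ← hx]

/-! ### Quasi-Lévy type measures with a density -/

namespace SignedMeasureOffZero

/-- `ν` has the density `D` on Borel sets bounded away from zero. -/
def HasDensity (ν : SignedMeasureOffZero) (D : ℝ → ℝ) : Prop :=
  ∀ r : ℝ, 0 < r → ∀ B : Set ℝ, IsBorelOff r B →
    IntegrableOn D B ∧ ν.toFun B = ∫ x in B, D x

theorem isBorelOff_compl_Ioo (r : ℝ) : IsBorelOff r (Set.Ioo (-r) r)ᶜ :=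
  ⟨measurableSet_Ioo.compl, Set.compl_inter_self _⟩

theorem restr_eq_withDensityᵥ {ν : SignedMeasureOffZero} {D : ℝ → ℝ} (h : ν.HasDensity D) {r : ℝ}
    (hr : 0 < r) :
    ν.restr r hr = volume.withDensityᵥ ((Set.Ioo (-r) r)ᶜ.indicator D) := by
  have hi : Integrable ((Set.Ioo (-r) r)ᶜ.indicator D) :=
    (h r hr _ (isBorelOff_compl_Ioo r)).1.integrable_indicator measurableSet_Ioo.compl
  ext B hB
  rw [restr_apply ν hr hB, withDensityᵥ_apply hi hB, (h r hr _ (IsBorelOff.diff hB r)).2,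
    setIntegral_indicator measurableSet_Ioo.compl, Set.sdiff_eq]

theorem toJordanDecomposition_withDensityᵥ {D : ℝ → ℝ} (hD : Measurable D) (hi : Integrable D) :
    (SignedMeasure.toJordanDecomposition (volume.withDensityᵥ D)).posPart =
      volume.withDensity (fun x => ENNReal.ofReal (D x)) ∧
    (SignedMeasure.toJordanDecomposition (volume.withDensityᵥ D)).negPart =
      volume.withDensity (fun x => ENNReal.ofReal (-D x)) := by
  have f₁ := isFiniteMeasure_withDensity_ofReal hi.2
  have f₂ := isFiniteMeasure_withDensity_ofReal hi.neg.2
  let j : JordanDecomposition ℝ :=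
    { posPart := volume.withDensity fun x => ENNReal.ofReal (D x)
      negPart := volume.withDensity fun x => ENNReal.ofReal (-D x)
      mutuallySingular := by
        have hs : MeasurableSet {x | D x ≤ 0} := measurableSet_le hD measurable_const
        refine ⟨{x | D x ≤ 0}, hs, ?_, ?_⟩
        · rw [withDensity_apply _ hs, setLIntegral_congr_fun (g := fun _ => 0) hs
            (fun x hx => ENNReal.ofReal_of_nonpos hx), lintegral_zero]
        · rw [withDensity_apply _ hs.compl, setLIntegral_congr_fun (g := fun _ => 0) hs.compl
            (fun x hx => ENNReal.ofReal_of_nonpos ?_), lintegral_zero]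
          simp only [Set.mem_compl_iff, Set.mem_ofPred_eq, not_le] at hx
          linarith }
  have hj : SignedMeasure.toJordanDecomposition (volume.withDensityᵥ D) = j := by
    apply SignedMeasure.toJordanDecomposition_eq
    rw [withDensityᵥ_eq_withDensity_pos_part_sub_withDensity_neg_part hi]
    rfl
  rw [hj]
  exact ⟨rfl, rfl⟩

theorem sum_restrict_shell (M : Measure ℝ) (h0 : M {0} = 0) :
    Measure.sum (fun n => M.restrict (shell n)) = M := by
  have hd : Pairwise (Function.onFun Disjoint shell) := disjoint_disjointed _
  rw [← Measure.restrict_iUnion hd measurableSet_shell, iUnion_shell]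
  refine Measure.restrict_eq_self_of_ae_mem ?_
  rw [ae_iff]
  simpa using h0

theorem withDensity_singleton_zero (f : ℝ → ENNReal) : (volume.withDensity f) {0} = 0 :=
  withDensity_absolutelyContinuous _ _ Real.volume_singleton

theorem HasDensity.parts_eq {ν : SignedMeasureOffZero} {D : ℝ → ℝ} (h : ν.HasDensity D)
    (hD : Measurable D) :
    ν.posPart = volume.withDensity (fun x => ENNReal.ofReal (D x)) ∧
    ν.negPart = volume.withDensity (fun x => ENNReal.ofReal (-D x)) := by
  have key : ∀ n : ℕ,
      (ν.restr (1 / ((n : ℝ) + 1)) Nat.one_div_pos_of_nat).toJordanDecomposition.posPart.restrict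
        (shell n) = (volume.withDensity fun x => ENNReal.ofReal (D x)).restrict (shell n) ∧
      (ν.restr (1 / ((n : ℝ) + 1)) Nat.one_div_pos_of_nat).toJordanDecomposition.negPart.restrict
        (shell n) = (volume.withDensity fun x => ENNReal.ofReal (-D x)).restrict (shell n) := by
    intro n
    have hr : 0 < 1 / ((n : ℝ) + 1) := Nat.one_div_pos_of_nat
    have hi : Integrable ((Set.Ioo (-(1 / ((n : ℝ) + 1))) (1 / ((n : ℝ) + 1)))ᶜ.indicator D) :=
      (h _ hr _ (isBorelOff_compl_Ioo _)).1.integrable_indicator measurableSet_Ioo.compl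
    obtain ⟨e₁, e₂⟩ := toJordanDecomposition_withDensityᵥ
      (hD.indicator (measurableSet_Ioo (a := -(1 / ((n : ℝ) + 1))) (b := 1 / ((n : ℝ) + 1))).compl) hi
    have hs : ∀ x ∈ shell n,
        (Set.Ioo (-(1 / ((n : ℝ) + 1))) (1 / ((n : ℝ) + 1)))ᶜ.indicator D x = D x := fun x hx =>
      Set.indicator_of_mem (disjointed_subset _ n hx) D
    rw [restr_eq_withDensityᵥ h hr, e₁, e₂, restrict_withDensity (measurableSet_shell n),
      restrict_withDensity (measurableSet_shell n), restrict_withDensity (measurableSet_shell n),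
      restrict_withDensity (measurableSet_shell n)]
    constructor
    · refine withDensity_congr_ae ?_
      filter_upwards [ae_restrict_mem (measurableSet_shell n)] with x hx
      rw [hs x hx]
    · refine withDensity_congr_ae ?_
      filter_upwards [ae_restrict_mem (measurableSet_shell n)] with x hx
      rw [hs x hx]
  constructor
  · rw [posPart, funext fun n => (key n).1, sum_restrict_shell _ (withDensity_singleton_zero _)]
  · rw [negPart, funext fun n => (key n).2, sum_restrict_shell _ (withDensity_singleton_zero _)]

theorem HasDensity.totalVariation_eq {ν : SignedMeasureOffZero} {D : ℝ → ℝ} (h : ν.HasDensity D)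
    (hD : Measurable D) : ν.totalVariation = volume.withDensity (fun x => ENNReal.ofReal |D x|) := by
  rw [totalVariation, (h.parts_eq hD).1, (h.parts_eq hD).2, ← withDensity_add_left (by fun_prop)]
  congr 1
  ext x
  rw [Pi.add_apply]
  rcases le_total 0 (D x) with hx | hx
  · rw [ENNReal.ofReal_of_nonpos (neg_nonpos.2 hx), abs_of_nonneg hx, add_zero]
  · rw [ENNReal.ofReal_of_nonpos hx, abs_of_nonpos hx, zero_add]

theorem HasDensity.integral_eq {ν : SignedMeasureOffZero} {D : ℝ → ℝ} (h : ν.HasDensity D)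
    (hD : Measurable D) {E : Type*} [NormedAddCommGroup E] [NormedSpace ℝ E] {φ : ℝ → E}
    (hφ : AEStronglyMeasurable φ) (hi : Integrable fun x => D x • φ x) :
    ν.integral φ = ∫ x, D x • φ x := by
  have fin : ∀ f : ℝ → ℝ, ∀ᵐ x, ENNReal.ofReal (f x) < ⊤ := fun f => by simp
  rw [integral, (h.parts_eq hD).1, (h.parts_eq hD).2,
    integral_withDensity_eq_integral_toReal_smul (by fun_prop) (fin _),
    integral_withDensity_eq_integral_toReal_smul (by fun_prop) (fin _), ← integral_sub]
  · congr 1 with x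
    rw [← sub_smul, ENNReal.toReal_ofReal', ENNReal.toReal_ofReal', max_zero_sub_eq_self]
  all_goals
    refine hi.mono (AEStronglyMeasurable.smul (Measurable.aestronglyMeasurable
      (by simp only [ENNReal.toReal_ofReal']; fun_prop)) hφ) (ae_of_all _ fun x => ?_)
    rw [norm_smul, norm_smul]
    gcongr
    simp only [ENNReal.toReal_ofReal', Real.norm_eq_abs]
    rw [abs_of_nonneg (le_max_right _ _)]
  · exact max_le (le_abs_self _) (abs_nonneg _)
  · exact max_le (neg_le_abs _) (abs_nonneg _)

end SignedMeasureOffZero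

theorem integrableOn_of_integrable_min_mul {D : ℝ → ℝ} (hD : Measurable D)
    (hi : Integrable fun x => min 1 (x ^ 2) * D x) {r : ℝ} (hr : 0 < r) {B : Set ℝ}
    (hB : IsBorelOff r B) : IntegrableOn D B := by
  refine (hi.norm.const_mul (min 1 (r ^ 2))⁻¹).integrableOn.mono' hD.aestronglyMeasurable ?_
  filter_upwards [ae_restrict_mem hB.1] with x hx
  have hxr : r ≤ |x| := by
    by_contra hlt
    have : x ∈ B ∩ Set.Ioo (-r) r := ⟨hx, abs_lt.1 (not_le.1 hlt)⟩
    rw [hB.2] at this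
    exact this
  have h1 : min 1 (r ^ 2) ≤ min 1 (x ^ 2) := by
    rw [← sq_abs x]
    gcongr
  have h0 : 0 < min 1 (r ^ 2) := by positivity
  rw [norm_mul, Real.norm_eq_abs (min 1 (x ^ 2)), abs_of_nonneg (h0.le.trans h1), ← mul_assoc]
  refine le_mul_of_one_le_left (norm_nonneg _) ?_
  rw [inv_mul_eq_div]
  exact (one_le_div h0).2 h1

/-- The quasi-Lévy type measure `D(x) dx`. -/
noncomputable def QuasiLevyTypeMeasure.ofDensity (D : ℝ → ℝ) (hD : Measurable D)
    (hi : Integrable fun x => min 1 (x ^ 2) * D x) : QuasiLevyTypeMeasure :=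
  let ν : SignedMeasureOffZero :=
    { toFun := fun B => ∫ x in B, D x
      empty := by simp
      hasSum_iUnion := fun r hr B hB hd => by
        refine hasSum_integral_iUnion (fun n => (hB n).1) hd
          (integrableOn_of_integrable_min_mul hD hi hr ⟨.iUnion fun n => (hB n).1, ?_⟩)
        rw [Set.iUnion_inter, Set.iUnion_eq_empty]
        exact fun n => (hB n).2 }
  { ν with
    lintegral_lt_top := by
      have h : ν.HasDensity D := fun r hr B hB =>
        ⟨integrableOn_of_integrable_min_mul hD hi hr hB, rfl⟩
      change ∫⁻ x, ENNReal.ofReal (min 1 (x ^ 2)) ∂ν.totalVariation < ⊤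
      rw [h.totalVariation_eq hD, lintegral_withDensity_eq_lintegral_mul _ (by fun_prop)
        (by fun_prop)]
      refine lt_of_eq_of_lt (lintegral_congr fun x => ?_) hi.2
      rw [Pi.mul_apply, ← ENNReal.ofReal_mul (abs_nonneg _), Real.enorm_eq_ofReal_abs, abs_mul,
        mul_comm, abs_of_nonneg (show 0 ≤ min 1 (x ^ 2) by positivity)] }

theorem QuasiLevyTypeMeasure.hasDensity_ofDensity {D : ℝ → ℝ} (hD : Measurable D)
    (hi : Integrable fun x => min 1 (x ^ 2) * D x) :
    (QuasiLevyTypeMeasure.ofDensity D hD hi).HasDensity D := fun _ hr _ hB =>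
  ⟨integrableOn_of_integrable_min_mul hD hi hr hB, rfl⟩

/-! ### Uniqueness of the characteristic triplet -/

/-- The integrand of the Lévy–Khintchine formula with truncation function `x 1_{[-1,1]}(x)`. -/
noncomputable def levyKernel (z x : ℝ) : ℂ :=
  Complex.exp (Complex.I * x * z) - 1
    - Complex.I * x * z * (Set.Icc (-1) 1).indicator (fun _ => (1 : ℂ)) x

theorem measurable_levyKernel (z : ℝ) : Measurable (levyKernel z) := by
  have : Measurable ((Set.Icc (-1 : ℝ) 1).indicator fun _ => (1 : ℂ)) :=
    measurable_const.indicator measurableSet_Icc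
  unfold levyKernel
  fun_prop

theorem norm_exp_I_sub_one_sub_le (t : ℝ) :
    ‖Complex.exp (Complex.I * t) - 1 - Complex.I * t‖ ≤ 3 * t ^ 2 := by
  have hn : ‖Complex.I * (t : ℂ)‖ = |t| := by simp
  rcases le_total |t| 1 with h | h
  · refine (Complex.norm_exp_sub_one_sub_id_le (by rwa [hn])).trans ?_
    rw [hn, sq_abs]
    nlinarith [sq_nonneg t]
  · have h1 : ‖Complex.exp (Complex.I * t) - 1‖ ≤ |t| := Real.norm_exp_I_mul_ofReal_sub_one_le
    refine (norm_sub_le _ _).trans ?_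
    rw [hn, ← sq_abs]
    nlinarith

theorem norm_levyKernel_le (z x : ℝ) : ‖levyKernel z x‖ ≤ (2 + 3 * z ^ 2) * min 1 (x ^ 2) := by
  by_cases hx : |x| ≤ 1
  · have h1 : x ^ 2 ≤ 1 := by rw [← sq_abs]; exact pow_le_one₀ (abs_nonneg x) hx
    rw [levyKernel, Set.indicator_of_mem (Set.mem_Icc.2 (abs_le.1 hx)), mul_one, min_eq_right h1]
    have h2 := norm_exp_I_sub_one_sub_le (x * z)
    rw [Complex.ofReal_mul, ← mul_assoc] at h2
    refine h2.trans ?_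
    nlinarith [sq_nonneg x]
  · have h1 : 1 ≤ x ^ 2 := by rw [← sq_abs]; exact one_le_pow₀ (not_le.1 hx).le
    rw [levyKernel, Set.indicator_of_notMem fun h => hx (abs_le.2 (Set.mem_Icc.1 h)), mul_zero,
      sub_zero, min_eq_left h1]
    refine (norm_exp_sub_one_le_two x z).trans ?_
    nlinarith [sq_nonneg z]

theorem integrable_exp_mul_I (P : Measure ℝ) [IsFiniteMeasure P] (z : ℝ) :
    Integrable (fun x : ℝ => Complex.exp (z * x * Complex.I)) P :=
  Integrable.of_bound (Continuous.aestronglyMeasurable (by fun_prop)) 1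
    (ae_of_all _ fun x => by simp [Complex.norm_exp])

section LevyIntegral

variable {M : Measure ℝ}

theorem integrable_levyKernel (hM : Integrable (fun x => min 1 (x ^ 2)) M) (z : ℝ) :
    Integrable (levyKernel z) M :=
  (hM.const_mul _).mono' (measurable_levyKernel z).aestronglyMeasurable
    (ae_of_all _ (norm_levyKernel_le z))

theorem continuous_integral_levyKernel (hM : Integrable (fun x => min 1 (x ^ 2)) M) :
    Continuous fun z => ∫ x, levyKernel z x ∂M := by
  refine continuous_iff_continuousAt.2 fun z₀ => ?_
  refine continuousAt_of_dominated (bound := fun x => (2 + 3 * (|z₀| + 1) ^ 2) * min 1 (x ^ 2))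
    (Eventually.of_forall fun z => (measurable_levyKernel z).aestronglyMeasurable) ?_
    (hM.const_mul _) (ae_of_all _ fun x => ?_)
  · filter_upwards [Metric.ball_mem_nhds z₀ one_pos] with z hz
    refine ae_of_all _ fun x => (norm_levyKernel_le z x).trans ?_
    have h1 : |z| ≤ |z₀| + 1 := by
      rw [Metric.mem_ball, Real.dist_eq] at hz
      linarith [abs_sub_abs_le_abs_sub z z₀]
    have h2 : z ^ 2 ≤ (|z₀| + 1) ^ 2 := by
      rw [← sq_abs z]
      gcongr
    have h3 : (0 : ℝ) ≤ min 1 (x ^ 2) := by positivity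
    gcongr
  · unfold levyKernel
    fun_prop

/-- The weight produced by second differences with steps `1` and `√2`.  As `√2` is irrational, it
vanishes only at `0`. -/
noncomputable def levyWeight (x : ℝ) : ℝ := (1 - Real.cos x) + (1 - Real.cos (Real.sqrt 2 * x))

theorem measurable_levyWeight : Measurable levyWeight := by
  unfold levyWeight
  fun_prop

theorem levyWeight_nonneg (x : ℝ) : 0 ≤ levyWeight x := by
  unfold levyWeight
  linarith [Real.cos_le_one x, Real.cos_le_one (Real.sqrt 2 * x)]

theorem levyWeight_le (x : ℝ) : levyWeight x ≤ 4 * min 1 (x ^ 2) := by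
  rw [mul_min_of_nonneg _ _ (by norm_num : (0 : ℝ) ≤ 4)]
  unfold levyWeight
  refine le_min ?_ ?_
  · linarith [Real.neg_one_le_cos x, Real.neg_one_le_cos (Real.sqrt 2 * x)]
  · have h1 := Real.one_sub_sq_div_two_le_cos (x := x)
    have h2 := Real.one_sub_sq_div_two_le_cos (x := Real.sqrt 2 * x)
    rw [mul_pow, Real.sq_sqrt (by norm_num)] at h2
    nlinarith [sq_nonneg x]

theorem levyWeight_pos {x : ℝ} (hx : x ≠ 0) : 0 < levyWeight x := by
  refine (levyWeight_nonneg x).lt_of_ne' fun h => ?_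
  unfold levyWeight at h
  have c1 : Real.cos x = 1 := by linarith [Real.cos_le_one x, Real.cos_le_one (Real.sqrt 2 * x)]
  have c2 : Real.cos (Real.sqrt 2 * x) = 1 := by
    linarith [Real.cos_le_one x, Real.cos_le_one (Real.sqrt 2 * x)]
  obtain ⟨k, hk⟩ := (Real.cos_eq_one_iff x).1 c1
  obtain ⟨l, hl⟩ := (Real.cos_eq_one_iff _).1 c2
  have hk0 : (k : ℝ) ≠ 0 := by
    rintro h0
    rw [h0, zero_mul] at hk
    exact hx hk.symm
  refine irrational_sqrt_two ⟨(l : ℚ) / k, ?_⟩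
  push_cast
  rw [div_eq_iff hk0]
  have hpi : (2 * Real.pi) ≠ 0 := by positivity
  apply mul_right_cancel₀ hpi
  rw [hl, mul_assoc, hk]

theorem integrable_levyWeight (hM : Integrable (fun x => min 1 (x ^ 2)) M) :
    Integrable levyWeight M :=
  (hM.const_mul 4).mono' measurable_levyWeight.aestronglyMeasurable (ae_of_all _ fun x => by
    rw [Real.norm_of_nonneg (levyWeight_nonneg x)]
    exact levyWeight_le x)

theorem second_difference_levyKernel (z t x : ℝ) :
    levyKernel (z + t) x + levyKernel (z - t) x - 2 * levyKernel z x =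
      Complex.exp (Complex.I * x * z) * (2 * Real.cos (t * x) - 2 : ℝ) := by
  have e1 : Complex.exp (Complex.I * x * (z + t : ℝ)) =
      Complex.exp (Complex.I * x * z) * Complex.exp ((t * x : ℝ) * Complex.I) := by
    rw [← Complex.exp_add]; congr 1; push_cast; ring
  have e2 : Complex.exp (Complex.I * x * (z - t : ℝ)) =
      Complex.exp (Complex.I * x * z) * Complex.exp (-(t * x : ℝ) * Complex.I) := by
    rw [← Complex.exp_add]; congr 1; push_cast; ring
  have e3 := Complex.two_cos (t * x : ℝ)
  rw [levyKernel, levyKernel, levyKernel, e1, e2]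
  push_cast at e3 ⊢
  linear_combination -Complex.exp (Complex.I * x * z) * e3

/-- The sum of two second differences of a Lévy–Khintchine integral is, up to the factor `-2`, the
characteristic function of a finite measure. -/
theorem charFun_withDensity_levyWeight (hM : Integrable (fun x => min 1 (x ^ 2)) M) (z : ℝ) :
    charFun (M.withDensity fun x => ENNReal.ofReal (levyWeight x)) z =
      -(1 / 2) * (((∫ x, levyKernel (z + 1) x ∂M) + (∫ x, levyKernel (z - 1) x ∂M) -
          2 * ∫ x, levyKernel z x ∂M) +
        ((∫ x, levyKernel (z + Real.sqrt 2) x ∂M) + (∫ x, levyKernel (z - Real.sqrt 2) x ∂M) -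
          2 * ∫ x, levyKernel z x ∂M)) := by
  have hi := integrable_levyKernel hM
  have key : ∀ t : ℝ, (∫ x, levyKernel (z + t) x ∂M) + (∫ x, levyKernel (z - t) x ∂M) -
      2 * ∫ x, levyKernel z x ∂M =
      ∫ x, Complex.exp (Complex.I * x * z) * (2 * Real.cos (t * x) - 2 : ℝ) ∂M := fun t => by
    have h := integral_sub ((hi (z + t)).add (hi (z - t))) ((hi z).const_mul 2)
    simp only [Pi.add_apply] at h
    rw [← integral_add (hi _) (hi _), ← integral_const_mul, ← h]
    simp_rw [second_difference_levyKernel]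
  have hik : ∀ t : ℝ, Integrable
      (fun x : ℝ => Complex.exp (Complex.I * x * z) * (2 * Real.cos (t * x) - 2 : ℝ)) M :=
    fun t => (((hi (z + t)).add (hi (z - t))).sub ((hi z).const_mul 2)).congr
      (ae_of_all _ fun x => second_difference_levyKernel z t x)
  rw [key, key, ← integral_add (hik _) (hik _), ← integral_const_mul, charFun_apply_real,
    integral_withDensity_eq_integral_toReal_smul measurable_levyWeight.ennreal_ofReal (by simp)]
  congr 1 with x
  rw [ENNReal.toReal_ofReal (levyWeight_nonneg x), Complex.real_smul, levyWeight, one_mul,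
    show (z : ℂ) * x * Complex.I = Complex.I * x * z by ring]
  push_cast
  ring

end LevyIntegral

namespace QuasiLevyTypeMeasure

variable (ν : QuasiLevyTypeMeasure)

theorem integrable_min_posPart : Integrable (fun x : ℝ => min 1 (x ^ 2)) ν.posPart := by
  refine ⟨by fun_prop, ?_⟩
  refine lt_of_le_of_lt ?_ ν.lintegral_lt_top
  rw [SignedMeasureOffZero.totalVariation, lintegral_add_measure]
  refine le_add_right (lintegral_mono fun x => ?_)
  rw [Real.enorm_of_nonneg (by positivity)]

theorem integrable_min_negPart : Integrable (fun x : ℝ => min 1 (x ^ 2)) ν.negPart := by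
  refine ⟨by fun_prop, ?_⟩
  refine lt_of_le_of_lt ?_ ν.lintegral_lt_top
  rw [SignedMeasureOffZero.totalVariation, lintegral_add_measure]
  refine le_add_left (lintegral_mono fun x => ?_)
  rw [Real.enorm_of_nonneg (by positivity)]

theorem toFun_eq {r : ℝ} (hr : 0 < r) {B : Set ℝ} (hB : IsBorelOff r B) :
    ν.posPart B ≠ ⊤ ∧ ν.negPart B ≠ ⊤ ∧
      ν.toFun B = (ν.posPart B).toReal - (ν.negPart B).toReal := by
  rw [ν.posPart_apply hr hB, ν.negPart_apply hr hB, ← ν.restr_apply_of_isBorelOff hr hB]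
  exact ⟨measure_ne_top _ _, measure_ne_top _ _,
    (ν.restr r hr).apply_eq_posPart_real_sub_negPart_real hB.1⟩

end QuasiLevyTypeMeasure

theorem eq_of_withDensity_levyWeight_eq {N N' : Measure ℝ} (h0 : N {0} = 0) (h0' : N' {0} = 0)
    (h : N.withDensity (fun x => ENNReal.ofReal (levyWeight x)) =
      N'.withDensity fun x => ENNReal.ofReal (levyWeight x)) : N = N' := by
  have key : ∀ P : Measure ℝ, P {0} = 0 →
      (P.withDensity fun x => ENNReal.ofReal (levyWeight x)).withDensity
        (fun x => ENNReal.ofReal (levyWeight x))⁻¹ = P := fun P hP => by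
    refine withDensity_inv_same measurable_levyWeight.ennreal_ofReal ?_ (by simp)
    have : ∀ᵐ x ∂P, x ≠ 0 := by
      rw [ae_iff]
      simpa using hP
    filter_upwards [this] with x hx
    exact (ENNReal.ofReal_pos.2 (levyWeight_pos hx)).ne'
  rw [← key N h0, h, key N' h0']

/-- **Uniqueness of the Lévy–Khintchine triplet**: after moving the negative parts to the other
side and taking second differences, both sides are characteristic functions of finite measures. -/
theorem IsCharacteristicTriplet.unique {μ : Measure ℝ} {a a' γ γ' : ℝ} {ν ν' : QuasiLevyTypeMeasure}
    (h : IsCharacteristicTriplet μ a γ ν) (h' : IsCharacteristicTriplet μ a' γ' ν') :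
    a = a' ∧ γ = γ' ∧ ∀ r : ℝ, 0 < r → ∀ B, IsBorelOff r B → ν.toFun B = ν'.toFun B := by
  have c₁ := continuous_integral_levyKernel ν.integrable_min_posPart
  have c₂ := continuous_integral_levyKernel ν.integrable_min_negPart
  have c₁' := continuous_integral_levyKernel ν'.integrable_min_posPart
  have c₂' := continuous_integral_levyKernel ν'.integrable_min_negPart
  have hk0 : ∀ x, levyKernel 0 x = 0 := fun x => by simp [levyKernel]
  have hlog : (fun z : ℝ => -(1 / 2) * (a : ℂ) * z ^ 2 + Complex.I * γ * z +
        ((∫ x, levyKernel z x ∂ν.posPart) - ∫ x, levyKernel z x ∂ν.negPart)) =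
      fun z : ℝ => -(1 / 2) * (a' : ℂ) * z ^ 2 + Complex.I * γ' * z +
        ((∫ x, levyKernel z x ∂ν'.posPart) - ∫ x, levyKernel z x ∂ν'.negPart) := by
    refine eq_of_exp_eq_of_continuous (by fun_prop) (by fun_prop) (by simp [hk0]) fun z => ?_
    exact (h z).symm.trans (h' z)
  set N := ν.posPart + ν'.negPart with hN
  set N' := ν'.posPart + ν.negPart with hN'
  have iN : Integrable (fun x : ℝ => min 1 (x ^ 2)) N :=
    ν.integrable_min_posPart.add_measure ν'.integrable_min_negPart
  have iN' : Integrable (fun x : ℝ => min 1 (x ^ 2)) N' :=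
    ν'.integrable_min_posPart.add_measure ν.integrable_min_negPart
  have N0 : N {0} = 0 := by
    rw [hN, Measure.add_apply, ν.posPart_singleton_zero, ν'.negPart_singleton_zero, add_zero]
  have N0' : N' {0} = 0 := by
    rw [hN', Measure.add_apply, ν'.posPart_singleton_zero, ν.negPart_singleton_zero, add_zero]
  have heq : ∀ z : ℝ, (∫ x, levyKernel z x ∂N) - (∫ x, levyKernel z x ∂N') =
      1 / 2 * ((a : ℂ) - a') * z ^ 2 - Complex.I * (γ - γ') * z := fun z => by
    rw [hN, hN', integral_add_measure (integrable_levyKernel ν.integrable_min_posPart z)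
      (integrable_levyKernel ν'.integrable_min_negPart z),
      integral_add_measure (integrable_levyKernel ν'.integrable_min_posPart z)
      (integrable_levyKernel ν.integrable_min_negPart z)]
    linear_combination congrFun hlog z
  set W := N.withDensity fun x => ENNReal.ofReal (levyWeight x) with hW
  set W' := N'.withDensity fun x => ENNReal.ofReal (levyWeight x) with hW'
  have fW : IsFiniteMeasure W := isFiniteMeasure_withDensity_ofReal (integrable_levyWeight iN).2
  have fW' : IsFiniteMeasure W' := isFiniteMeasure_withDensity_ofReal (integrable_levyWeight iN').2
  -- a Gaussian part contributes a constant to the second differences, that is, an atom at `0`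
  have hchar : ∀ z, charFun W z + (3 / 2 * (a - a') : ℝ) = charFun W' z := fun z => by
    rw [hW, hW', charFun_withDensity_levyWeight iN, charFun_withDensity_levyWeight iN']
    have hs : ((Real.sqrt 2 : ℝ) : ℂ) ^ 2 = 2 := by
      rw [← Complex.ofReal_pow, Real.sq_sqrt (by norm_num), Complex.ofReal_ofNat]
    have h1 := heq (z + 1)
    have h2 := heq (z - 1)
    have h3 := heq (z + Real.sqrt 2)
    have h4 := heq (z - Real.sqrt 2)
    have h5 := heq z
    push_cast at h1 h2 h3 h4 ⊢
    linear_combination -(1 / 2 : ℂ) * (h1 + h2 + h3 + h4) + 2 * h5 - (a - a') / 2 * hs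
  have hP : W + ENNReal.ofReal (3 / 2 * (a - a')) • Measure.dirac 0 =
      W' + ENNReal.ofReal (3 / 2 * (a' - a)) • Measure.dirac 0 := by
    have f1 : ∀ s : ℝ, IsFiniteMeasure (ENNReal.ofReal s • Measure.dirac (0 : ℝ)) := fun s =>
      Measure.smul_finite _ ENNReal.ofReal_ne_top
    have f2 := f1 (3 / 2 * (a - a'))
    have f3 := f1 (3 / 2 * (a' - a))
    refine Measure.ext_of_charFun (funext fun z => ?_)
    have hc := hchar z
    simp only [charFun_apply_real] at hc ⊢
    rw [integral_add_measure (integrable_exp_mul_I _ z) (integrable_exp_mul_I _ z),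
      integral_add_measure (integrable_exp_mul_I _ z) (integrable_exp_mul_I _ z),
      integral_smul_measure, integral_smul_measure, integral_dirac, ← hc]
    simp only [ENNReal.toReal_ofReal', Complex.real_smul, Complex.ofReal_zero, mul_zero, zero_mul,
      Complex.exp_zero, mul_one]
    have := max_zero_sub_eq_self (3 / 2 * (a - a'))
    rw [show 3 / 2 * (a' - a) = -(3 / 2 * (a - a')) by ring, add_assoc, ← Complex.ofReal_add]
    congr 2
    linarith
  have haa : a = a' := by
    have h1 := congrArg (fun P : Measure ℝ => P {0}) hP
    have w0 : W {0} = 0 := withDensity_absolutelyContinuous _ _ N0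
    have w0' : W' {0} = 0 := withDensity_absolutelyContinuous _ _ N0'
    simp only [Measure.add_apply, w0, w0', Measure.smul_apply, zero_add, smul_eq_mul,
      Measure.dirac_apply_of_mem (Set.mem_singleton (0 : ℝ)), mul_one] at h1
    rcases lt_trichotomy a a' with hlt | he | hlt
    · rw [ENNReal.ofReal_of_nonpos (by linarith), eq_comm, ENNReal.ofReal_eq_zero] at h1
      linarith
    · exact he
    · rw [ENNReal.ofReal_of_nonpos (p := 3 / 2 * (a' - a)) (by linarith),
        ENNReal.ofReal_eq_zero] at h1
      linarith
  subst haa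
  have hNN : N = N' := by
    refine eq_of_withDensity_levyWeight_eq N0 N0' ?_
    simpa using hP
  refine ⟨rfl, ?_, fun r hr B hB => ?_⟩
  · have h1 := heq 1
    rw [hNN] at h1
    simp only [sub_self, mul_zero, zero_mul, zero_sub, Complex.ofReal_one, mul_one, eq_comm,
      neg_eq_zero, mul_eq_zero, Complex.I_ne_zero, false_or, sub_eq_zero] at h1
    exact_mod_cast h1
  · obtain ⟨p1, p2, e⟩ := ν.toFun_eq hr hB
    obtain ⟨p1', p2', e'⟩ := ν'.toFun_eq hr hB
    have h1 := congrArg (fun P : Measure ℝ => (P B).toReal) hNN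
    simp only [hN, hN', Measure.add_apply] at h1
    rw [ENNReal.toReal_add p1 p2', ENNReal.toReal_add p1' p2] at h1
    rw [e, e']
    linarith

/-! ### Mixtures of a point mass and an absolutely continuous law -/

theorem integrable_real_mul_indexDensity {g : ℝ → ℝ} (hg : Integrable g) (m : ℝ) {φ : ℝ → ℝ}
    (hφ : Measurable φ) (hB : ∀ x, |φ x| ≤ 1) (hC : ∀ x, |φ x| ≤ |x|) :
    Integrable fun x : ℝ => φ x * indexDensity g m x := by
  have h := (integrable_mul_indexDensity hg m (φ := fun x => (φ x : ℂ)) (by fun_prop)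
    (B := 1) (C := 1) (by simpa using hB) (by simpa using hC)).re
  refine h.congr (ae_of_all _ fun x => ?_)
  simp

theorem abs_indicator_Icc_le (x : ℝ) : |(Set.Icc (-1) 1).indicator (fun x : ℝ => x) x| ≤ 1 ∧
    |(Set.Icc (-1) 1).indicator (fun x : ℝ => x) x| ≤ |x| := by
  by_cases hx : x ∈ Set.Icc (-1 : ℝ) 1
  · rw [Set.indicator_of_mem hx]
    exact ⟨abs_le.2 (Set.mem_Icc.1 hx), le_rfl⟩
  · rw [Set.indicator_of_notMem hx]
    simp

theorem integrable_indicator_mul_indexDensity {g : ℝ → ℝ} (hg : Integrable g) (m : ℝ) :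
    Integrable fun x : ℝ =>
      (Set.Icc (-1) 1).indicator (fun x : ℝ => x) x * indexDensity g m x :=
  integrable_real_mul_indexDensity hg m (measurable_id.indicator measurableSet_Icc)
    (fun x => (abs_indicator_Icc_le x).1) fun x => (abs_indicator_Icc_le x).2

theorem integrable_min_mul_indexDensity {g : ℝ → ℝ} (hg : Integrable g) (m : ℝ) :
    Integrable fun x : ℝ => min 1 (x ^ 2) * indexDensity g m x := by
  refine integrable_real_mul_indexDensity hg m (by fun_prop) (fun x => ?_) fun x => ?_
  · rw [abs_of_nonneg (by positivity)]
    exact min_le_left _ _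
  · rw [abs_of_nonneg (by positivity), ← sq_abs]
    rcases le_total |x| 1 with hx | hx
    · exact (min_le_right _ _).trans (by nlinarith [abs_nonneg x])
    · exact (min_le_left _ _).trans hx

/-- A function that dominates a positive multiple of `1 / |x|`, up to an integrable error, on one
side of the origin has infinite positive part. -/
theorem lintegral_ofReal_eq_top {h g : ℝ → ℝ} (hh : Measurable h) (hg : Integrable g) {c : ℝ}
    (hc : 0 < c) {s : Set ℝ} (hs : MeasurableSet s) (hs1 : ∀ x ∈ s, |x| ≤ 1)
    (hinv : ¬ IntegrableOn (fun x : ℝ => x⁻¹) s)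
    (hle : ∀ x ∈ s, c * (Real.exp (-|x|) / |x|) ≤ h x + |g x|) :
    ∫⁻ x, ENNReal.ofReal (h x) = ⊤ := by
  by_contra htop
  have h1 := integrable_toReal_of_lintegral_ne_top (by fun_prop) htop
  refine hinv (((h1.add hg.norm).const_mul (Real.exp 1 / c)).integrableOn.mono'
    measurable_inv.aestronglyMeasurable ?_)
  filter_upwards [ae_restrict_mem hs] with x hx
  have h2 : h x ≤ (ENNReal.ofReal (h x)).toReal := by
    rw [ENNReal.toReal_ofReal']
    exact le_max_left _ _
  have h3 : Real.exp (-1) ≤ Real.exp (-|x|) := Real.exp_le_exp.2 (by linarith [hs1 x hx])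
  rw [norm_inv, Real.norm_eq_abs, Pi.add_apply, Real.norm_eq_abs]
  calc |x|⁻¹ = Real.exp 1 / c * (c * (Real.exp (-1) / |x|)) := by
        rw [Real.exp_neg]
        field_simp
    _ ≤ Real.exp 1 / c * (c * (Real.exp (-|x|) / |x|)) := by gcongr
    _ ≤ Real.exp 1 / c * ((ENNReal.ofReal (h x)).toReal + |g x|) := by
        gcongr
        linarith [hle x hx]

theorem not_integrableOn_inv_Ioc_zero_one : ¬ IntegrableOn (fun x : ℝ => x⁻¹) (Set.Ioc 0 1) := by
  rw [← intervalIntegrable_iff_integrableOn_Ioc_of_le zero_le_one, intervalIntegrable_inv_iff]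
  simp

theorem not_integrableOn_inv_Ioc_neg_one_zero :
    ¬ IntegrableOn (fun x : ℝ => x⁻¹) (Set.Ioc (-1) 0) := by
  rw [← intervalIntegrable_iff_integrableOn_Ioc_of_le (by norm_num), intervalIntegrable_inv_iff]
  simp

theorem lintegral_ofReal_mul_indexDensity_eq_top {g : ℝ → ℝ} (hgm : Measurable g)
    (hg : Integrable g) {m σ : ℝ} (hσ : |σ| = 1) (hm : m ≠ 0) :
    ∫⁻ x, ENNReal.ofReal (σ * indexDensity g m x) = ⊤ := by
  have hD := measurable_indexDensity hgm m
  have hσg : ∀ x, -|g x| ≤ σ * g x := fun x => by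
    have := neg_abs_le (σ * g x)
    rwa [abs_mul, hσ, one_mul] at this
  have hσ0 : σ ≠ 0 := by
    rintro rfl
    simp at hσ
  rcases lt_or_gt_of_ne (mul_ne_zero hσ0 hm) with hneg | hpos
  · refine lintegral_ofReal_eq_top (c := -(σ * m)) (by fun_prop) hg (by linarith) measurableSet_Ioc
      (fun x hx => ?_) not_integrableOn_inv_Ioc_neg_one_zero fun x hx => ?_
    · rw [abs_of_nonpos hx.2]
      linarith [hx.1]
    · have e : σ * indexDensity g m x = σ * g x + -(σ * m) * (Real.exp (-|x|) / |x|) := by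
        rw [indexDensity_eq, abs_of_nonpos hx.2, div_neg]
        ring
      rw [e]
      linarith [hσg x]
  · refine lintegral_ofReal_eq_top (c := σ * m) (by fun_prop) hg hpos measurableSet_Ioc
      (fun x hx => ?_) not_integrableOn_inv_Ioc_zero_one fun x hx => ?_
    · rw [abs_of_pos hx.1]
      exact hx.2
    · have e : σ * indexDensity g m x = σ * g x + σ * m * (Real.exp (-|x|) / |x|) := by
        rw [indexDensity_eq, abs_of_pos hx.1]
        ring
      rw [e]
      linarith [hσg x]

theorem charFun_dirac_add_withDensity {μ : Measure ℝ} {p x₀ : ℝ} {f : ℝ → ℝ}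
    (hp : p ∈ Set.Ioo (0 : ℝ) 1) (hf_meas : Measurable f) (hf_nonneg : ∀ x, 0 ≤ f x)
    (hf_int : Integrable f)
    (hμ : μ = ENNReal.ofReal p • Measure.dirac x₀ +
      ENNReal.ofReal (1 - p) • volume.withDensity (fun x => ENNReal.ofReal (f x))) (z : ℝ) :
    charFun μ z = p * Complex.exp (Complex.I * x₀ * z) +
      ∫ x : ℝ, Complex.exp (Complex.I * x * z) * ((1 - p) * f x : ℝ) := by
  have hfin : IsFiniteMeasure (volume.withDensity fun x => ENNReal.ofReal (f x)) :=
    isFiniteMeasure_withDensity_ofReal hf_int.2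
  rw [hμ, charFun_apply_real, integral_add_measure
    ((integrable_exp_mul_I _ z).smul_measure ENNReal.ofReal_ne_top)
    ((integrable_exp_mul_I _ z).smul_measure ENNReal.ofReal_ne_top),
    integral_smul_measure, integral_smul_measure, integral_dirac,
    integral_withDensity_eq_integral_toReal_smul (by fun_prop) (by simp),
    ENNReal.toReal_ofReal hp.1.le, ENNReal.toReal_ofReal (by linarith [hp.2]), ← integral_smul,
    Complex.real_smul]
  congr 1
  · congr 2
    ring
  · congr 1 with x
    rw [ENNReal.toReal_ofReal (hf_nonneg x), Complex.real_smul, Complex.real_smul,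
      show (z : ℂ) * x * Complex.I = Complex.I * x * z by ring]
    push_cast
    ring

open FourierTransform in
/-- For a mixture of a point mass and an absolutely continuous law whose characteristic function has
no zeros, the index is an integer and the Lévy–Khintchine representation holds. -/
theorem exists_triplet_of_charFun_ne_zero (μ : Measure ℝ) [IsProbabilityMeasure μ] (p x₀ : ℝ)
    (f : ℝ → ℝ) (hp : p ∈ Set.Ioo (0 : ℝ) 1) (hf_meas : Measurable f) (hf_nonneg : ∀ x, 0 ≤ f x)
    (hf_int : Integrable f)
    (hμ : μ = ENNReal.ofReal p • Measure.dirac x₀ +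
      ENNReal.ofReal (1 - p) • volume.withDensity (fun x => ENNReal.ofReal (f x)))
    (hne : ∀ z : ℝ, charFun μ z ≠ 0) :
    ∃ (m : ℤ) (g : ℝ → ℝ),
      HasIndex (charFun (Measure.conv μ (Measure.dirac (-x₀)))) m ∧ Measurable g ∧ Integrable g ∧
      ∃ ν : QuasiLevyTypeMeasure, ν.HasDensity (indexDensity g m) ∧
        IsCharacteristicTriplet μ 0
          (x₀ + ∫ x, (Set.Icc (-1) 1).indicator (fun x : ℝ => x) x * indexDensity g m x) ν := by
  set F := charFun (Measure.conv μ (Measure.dirac (-x₀))) with hFdef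
  have hFμ : ∀ z, F z = charFun μ z * Complex.exp (-(Complex.I * x₀ * z)) := fun z => by
    rw [hFdef, charFun_conv, charFun_dirac]
    congr 2
    simp
    ring
  set k : ℝ → ℂ := fun x => (((1 - p) * f (x + x₀) : ℝ) : ℂ) with hk
  have hki : Integrable k := ((hf_int.comp_add_right x₀).const_mul (1 - p)).ofReal
  have hF : ∀ z, F z = p + 𝓕 k (-z / (2 * Real.pi)) := fun z => by
    rw [hFμ, charFun_dirac_add_withDensity hp hf_meas hf_nonneg hf_int hμ, fourier_neg_div_two_pi,
      add_mul, mul_assoc, ← Complex.exp_add, add_neg_cancel, Complex.exp_zero, mul_one,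
      ← integral_mul_const, ← integral_add_right_eq_self _ x₀]
    congr 2 with x
    rw [mul_right_comm, ← Complex.exp_add]
    congr 2
    push_cast
    ring
  obtain ⟨m, g, hind, hgm, hg, hexp⟩ := exists_index_and_density hki
    (c := p) (Complex.ofReal_ne_zero.2 hp.1.ne') hF
    (fun z => by rw [hFμ]; exact mul_ne_zero (hne z) (Complex.exp_ne_zero _))
    (by rw [hFdef, charFun_zero]; simp) (fun z => by rw [hFdef, charFun_neg])
  have hD := measurable_indexDensity hgm m
  set ν := QuasiLevyTypeMeasure.ofDensity (indexDensity g m) hD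
    (integrable_min_mul_indexDensity hg m)
  have hν : ν.HasDensity (indexDensity g m) :=
    QuasiLevyTypeMeasure.hasDensity_ofDensity hD (integrable_min_mul_indexDensity hg m)
  refine ⟨m, g, hind, hgm, hg, ν, hν, fun z => ?_⟩
  have i1 : Integrable fun x : ℝ =>
      (Complex.exp (Complex.I * x * z) - 1) * (indexDensity g m x : ℂ) :=
    integrable_mul_indexDensity hg m (by fun_prop) (fun x => norm_exp_sub_one_le_two x z)
      fun x => norm_exp_sub_one_le x z
  have i2 : Integrable fun x : ℝ => Complex.I * z *
      (((Set.Icc (-1) 1).indicator (fun x : ℝ => x) x * indexDensity g m x : ℝ) : ℂ) :=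
    (integrable_indicator_mul_indexDensity hg m).ofReal.const_mul _
  have e : ∀ x : ℝ, indexDensity g m x • levyKernel z x =
      (Complex.exp (Complex.I * x * z) - 1) * (indexDensity g m x : ℂ) - Complex.I * z *
      (((Set.Icc (-1) 1).indicator (fun x : ℝ => x) x * indexDensity g m x : ℝ) : ℂ) := fun x => by
    rw [levyKernel, Complex.real_smul]
    by_cases hx : x ∈ Set.Icc (-1 : ℝ) 1
    · rw [Set.indicator_of_mem hx, Set.indicator_of_mem hx]
      push_cast
      ring
    · rw [Set.indicator_of_notMem hx, Set.indicator_of_notMem hx]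
      push_cast
      ring
  have hint := hν.integral_eq hD (φ := levyKernel z) (measurable_levyKernel z).aestronglyMeasurable
    ((i1.sub i2).congr (ae_of_all _ fun x => (e x).symm))
  have hint' : ν.integral (fun x : ℝ => Complex.exp (Complex.I * x * z) - 1
        - Complex.I * x * z * (Set.Icc (-1) 1).indicator (fun _ => (1 : ℂ)) x) =
      (∫ x : ℝ, (Complex.exp (Complex.I * x * z) - 1) * (indexDensity g m x : ℂ)) -
        Complex.I * z * ((∫ x, (Set.Icc (-1) 1).indicator (fun x : ℝ => x) x *
          indexDensity g m x : ℝ) : ℂ) := by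
    refine hint.trans ?_
    simp_rw [e]
    rw [integral_sub i1 i2, integral_const_mul, integral_complex_ofReal]
  have hμF : charFun μ z = F z * Complex.exp (Complex.I * x₀ * z) := by
    rw [hFμ, mul_assoc, ← Complex.exp_add, neg_add_cancel, Complex.exp_zero, mul_one]
  rw [hμF, hexp, ← Complex.exp_add, hint']
  congr 1
  push_cast
  ring

theorem mainTheorem1 (μ : Measure ℝ) [IsProbabilityMeasure μ] (p x₀ : ℝ) (f : ℝ → ℝ)
    (hp : p ∈ Set.Ioo (0 : ℝ) 1) (hf_meas : Measurable f) (hf_nonneg : ∀ x, 0 ≤ f x)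
    (hf_int : ∫ x, f x = 1)
    (hμ : μ = ENNReal.ofReal p • Measure.dirac x₀ +
      ENNReal.ofReal (1 - p) • volume.withDensity (fun x => ENNReal.ofReal (f x))) :
    (IsQuasiInfinitelyDivisible μ ↔ ∀ z : ℝ, charFun μ z ≠ 0) ∧
    (IsQuasiInfinitelyDivisible μ →
      ∃ (m : ℤ) (g : ℝ → ℝ),
        HasIndex (charFun (Measure.conv μ (Measure.dirac (-x₀)))) m ∧
        Measurable g ∧ Integrable g ∧
        ∀ (a γ : ℝ) (ν : QuasiLevyTypeMeasure), IsCharacteristicTriplet μ a γ ν →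
          (∀ r : ℝ, 0 < r → ∀ B : Set ℝ, IsBorelOff r B →
            IntegrableOn (indexDensity g m) B ∧ ν.toFun B = ∫ x in B, indexDensity g m x) ∧
          ∫⁻ x in Set.Icc (-1) 1, ENNReal.ofReal |x| ∂ν.totalVariation < ⊤ ∧
          drift γ ν = x₀ ∧
          a = 0 ∧
          (ν.totalVariation Set.univ < ⊤ ↔ m = 0) ∧
          (m ≠ 0 → ν.negPart Set.univ = ⊤ ∧ ν.posPart Set.univ = ⊤)) := by
  have hfi : Integrable f := integrable_of_integral_eq_one hf_int
  have hne_of : IsQuasiInfinitelyDivisible μ → ∀ z : ℝ, charFun μ z ≠ 0 := by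
    rintro ⟨a, γ, ν, h⟩ z
    rw [h z]
    exact Complex.exp_ne_zero _
  refine ⟨⟨hne_of, fun hne => ?_⟩, fun hq => ?_⟩
  · obtain ⟨m, g, -, -, -, ν, -, h⟩ :=
      exists_triplet_of_charFun_ne_zero μ p x₀ f hp hf_meas hf_nonneg hfi hμ hne
    exact ⟨_, _, ν, h⟩
  obtain ⟨m, g, hind, hgm, hg, ν₀, hν₀, h₀⟩ :=
    exists_triplet_of_charFun_ne_zero μ p x₀ f hp hf_meas hf_nonneg hfi hμ (hne_of hq)
  refine ⟨m, g, hind, hgm, hg, fun a γ ν h => ?_⟩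
  obtain ⟨rfl, rfl, hB⟩ := h.unique h₀
  have hD := measurable_indexDensity hgm m
  have hν : ν.HasDensity (indexDensity g m) := fun r hr B hB' => by
    rw [hB r hr B hB']
    exact hν₀ r hr B hB'
  have hpos := (hν.parts_eq hD).1
  have hneg := (hν.parts_eq hD).2
  have htv := hν.totalVariation_eq hD
  have hinf : m ≠ 0 → ν.negPart Set.univ = ⊤ ∧ ν.posPart Set.univ = ⊤ := fun hm => by
    rw [hpos, hneg, withDensity_apply _ .univ, withDensity_apply _ .univ, Measure.restrict_univ]
    constructor
    · simpa using lintegral_ofReal_mul_indexDensity_eq_top hgm hg (σ := -1) (by simp)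
        (Int.cast_ne_zero.2 hm)
    · simpa using lintegral_ofReal_mul_indexDensity_eq_top hgm hg (σ := 1) (by simp)
        (Int.cast_ne_zero.2 hm)
  refine ⟨hν, ?_, ?_, rfl, ⟨fun hfin => ?_, fun hm => ?_⟩, hinf⟩
  · rw [htv, restrict_withDensity measurableSet_Icc,
      lintegral_withDensity_eq_lintegral_mul _ (by fun_prop) (by fun_prop)]
    have hi := (integrable_indicator_mul_indexDensity hg m).integrableOn (s := Set.Icc (-1) 1)
    refine lt_of_eq_of_lt (setLIntegral_congr_fun measurableSet_Icc fun x hx => ?_) hi.2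
    rw [Pi.mul_apply, ← ENNReal.ofReal_mul (abs_nonneg _), Real.enorm_eq_ofReal_abs, abs_mul,
      mul_comm]
    simp only [Set.indicator_of_mem hx]
  · rw [drift, hν.integral_eq hD (φ := (Set.Icc (-1) 1).indicator fun x : ℝ => x)
      (measurable_id.indicator measurableSet_Icc).aestronglyMeasurable]
    · simp only [smul_eq_mul, mul_comm (indexDensity g m _)]
      exact add_sub_cancel_right _ _
    · simp only [smul_eq_mul, mul_comm (indexDensity g m _)]
      exact integrable_indicator_mul_indexDensity hg m
  · by_contra hm
    rw [SignedMeasureOffZero.totalVariation, Measure.add_apply, (hinf hm).2, top_add] at hfin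
    exact lt_irrefl _ hfin
  · subst hm
    rw [htv, withDensity_apply _ .univ, Measure.restrict_univ]
    have e : indexDensity g ((0 : ℤ) : ℝ) = g := funext fun x => by simp [indexDensity_eq]
    rw [e]
    refine lt_of_eq_of_lt (lintegral_congr fun x => ?_) hg.2
    rw [Real.enorm_eq_ofReal_abs]
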